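/- Let $G$ be a connected (real, finite-dimensional) Lie group with Lie algebra $\mathfrak g$, let $H\subset G$ be a closed connected subgroup with Lie algebra $\mathfrak h$, and give $G/H$ the smooth structure for which $\pi:G\to G/H$ is a submersion; put $o=H\in G/H$. Let $G/H$ carry a $\mathbb{Z}_2^k$-symmetric structure, that is, a grading $\mathfrak g=\bigoplus_{\gamma\in\mathbb{Z}_2^k}\mathfrak g_\gamma$, $[\mathfrak g_\gamma,\mathfrak g_{\gamma'}]\subset\mathfrak g_{\gamma\gamma'}$, with $\mathfrak g_e=\mathfrak h$, such that for every $a\in\mathbb{Z}_2^k$ the automorphism $\sigma_a$ of $\mathfrak g$ that acts on $\mathfrak g_\gamma$ as $(-1)^{a_1\gamma_1+\dots+a_k\gamma_k}$ is the differential of an automorphism $s_a$ of the Lie group $G$. Put $\mathfrak m=\bigoplus_{\gamma\ne e}\mathfrak g_\gamma$, and let $[X,Y]_{\mathfrak m}$ denote the projection of $[X,Y]$ on $\mathfrak m$ along $\mathfrak h$. A $G$-invariant Riemannian metric $g$ on $G/H$ is called adapted to the structure if for all $a\in\mathbb{Z}_2^k$ and $x=g_0H\in G/H$ the symmetry $s_{a,x}:G/H\to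 G/H$, $hH\mapsto g_0\,s_a(g_0^{-1}h)H$ ($h\in G$), is a (well-defined) isometric diffeomorphism. 1. The map $g\mapsto B$, $B(X,Y)=g_o(d\pi_1X,d\pi_1Y)$ for $X,Y\in\mathfrak m$, is a bijection from the set of $G$-invariant Riemannian metrics on $G/H$ adapted to the $\mathbb{Z}_2^k$-symmetric structure onto the set of positive-definite symmetric bilinear forms $B$ on $\mathfrak m$ that are $\mathrm{ad}(H)$-invariant, i.e. $B([Z,X],Y)+B(X,[Z,Y])=0$ for $Z\in\mathfrak h$ and $X,Y\in\mathfrak m$, and satisfy $B(\mathfrak g_\gamma,\mathfrak g_{\gamma'})=0$ for all $\gamma\ne\gamma'$ in $\mathbb{Z}_2^k\setminus\{e\}$. 2. For every such $B$ there is exactly one symmetric bilinear map $U:\mathfrak m\times\mathfrak m\to\mathfrak m$ with $2B(U(X,Y),Z)=B(X,[Z,Y]_{\mathfrak m})+B([Z,X]_{\mathfrak m},Y)$ for all $X,Y,Z\in\mathfrak m$. -/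

import Mathlib

open scoped Manifold ContDiff

namespace Z2kSymmetric

section LieGroup

variable {E : Type*} [NormedAddCommGroup E] [NormedSpace ℝ E]
  {G : Type*} [TopologicalSpace G] [ChartedSpace E G] [Group G]

/-- The Lie algebra `𝔥` of a closed subgroup `H` of the Lie group `G`, as a subset of the Lie
algebra of `G`: the velocities at time `0` of the curves through `1` that lie in `H` and are smooth
in `G` near time `0`. -/
def subgroupLieAlgebra (E : Type*) [NormedAddCommGroup E] [NormedSpace ℝ E] {G : Type*}
    [TopologicalSpace G] [ChartedSpace E G] [Group G] (H : Subgroup G) :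
    Set (GroupLieAlgebra 𝓘(ℝ, E) G) :=
  {X | ∃ c : ℝ → G, c 0 = 1 ∧ (∀ t, c t ∈ H) ∧ ContMDiffAt 𝓘(ℝ, ℝ) 𝓘(ℝ, E) ∞ c 0 ∧
    (mfderiv 𝓘(ℝ, ℝ) 𝓘(ℝ, E) c 0 (1 : ℝ) : E) = X}

/-- The differential at the identity of a group endomorphism `s` of `G`, as an endomorphism of the
Lie algebra of `G` (recall that `s 1 = 1`). -/
noncomputable def differentialAtOne (E : Type*) [NormedAddCommGroup E] [NormedSpace ℝ E]
    {G : Type*} [TopologicalSpace G] [ChartedSpace E G] [Group G] (s : G ≃* G) :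
    GroupLieAlgebra 𝓘(ℝ, E) G →L[ℝ] GroupLieAlgebra 𝓘(ℝ, E) G :=
  mfderiv 𝓘(ℝ, E) 𝓘(ℝ, E) s (1 : G)

/-- The sign `(-1) ^ (a₁ γ₁ + ⋯ + a_k γ_k)`: the value at `γ` of the character of `ℤ₂ᵏ` with
index `a`. -/
def sign {k : ℕ} (a γ : Fin k → ZMod 2) : ℝ := (-1) ^ (∑ i, a i * γ i).val

/-- A `ℤ₂ᵏ`-symmetric structure on the homogeneous space `G ⧸ H`: a `ℤ₂ᵏ`-grading
`𝔤 = ⨁ 𝔤_γ` of the Lie algebra of `G` with `𝔤_e = 𝔥`, together with the automorphisms `s_a` of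
the Lie group `G` whose differentials are the automorphisms `σ_a` of `𝔤` attached to the grading,
where `σ_a` is multiplication by `(-1) ^ (a · γ)` on `𝔤_γ`. The group `ℤ₂ᵏ` is written
additively, so that its identity is `0`. -/
structure SymmetricStructure (E : Type*) [NormedAddCommGroup E] [NormedSpace ℝ E] {G : Type*}
    [TopologicalSpace G] [ChartedSpace E G] [Group G] (k : ℕ) (H : Subgroup G) where
  /-- the homogeneous component `𝔤_γ` -/
  grade : (Fin k → ZMod 2) → Submodule ℝ (GroupLieAlgebra 𝓘(ℝ, E) G)
  isInternal : DirectSum.IsInternal grade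
  bracket_mem : ∀ γ₁ γ₂, ∀ X ∈ grade γ₁, ∀ Y ∈ grade γ₂, ⁅X, Y⁆ ∈ grade (γ₁ + γ₂)
  grade_zero : (grade 0 : Set (GroupLieAlgebra 𝓘(ℝ, E) G)) = subgroupLieAlgebra E H
  /-- the automorphism `s_a` of `G` -/
  symm : (Fin k → ZMod 2) → (G ≃* G)
  contMDiff_symm : ∀ a, ContMDiff 𝓘(ℝ, E) 𝓘(ℝ, E) ∞ (symm a)
  contMDiff_symm_inv : ∀ a, ContMDiff 𝓘(ℝ, E) 𝓘(ℝ, E) ∞ (symm a).symm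
  differential_symm : ∀ a γ, ∀ X ∈ grade γ, differentialAtOne E (symm a) X = sign a γ • X

namespace SymmetricStructure

variable {k : ℕ} {H : Subgroup G} (S : SymmetricStructure E k H)

/-- `𝔪 = ⨁_{γ ≠ e} 𝔤_γ`. -/
noncomputable def m : Submodule ℝ (GroupLieAlgebra 𝓘(ℝ, E) G) := ⨆ γ, ⨆ _ : γ ≠ 0, S.grade γ

theorem isCompl_m : IsCompl S.m (S.grade 0) := by
  refine ⟨(S.isInternal.submodule_iSupIndep 0).symm, ?_⟩
  rw [codisjoint_iff, eq_top_iff, ← S.isInternal.submodule_iSup_eq_top]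
  refine iSup_le fun γ => ?_
  by_cases h : γ = 0
  · subst h
    exact le_sup_right
  · exact le_sup_of_le_left (le_iSup₂_of_le γ h le_rfl)

/-- The projection `X ↦ X_𝔪` of `𝔤 = 𝔪 ⊕ 𝔥` on `𝔪`. -/
noncomputable def projM : GroupLieAlgebra 𝓘(ℝ, E) G →ₗ[ℝ] S.m :=
  S.m.projectionOnto (S.grade 0) S.isCompl_m

/-- `B` is `ad(H)`-invariant: `B([Z,X],Y) + B(X,[Z,Y]) = 0` for `Z ∈ 𝔥` and `X, Y ∈ 𝔪`.
For such `X` and `Z` the bracket `[Z,X]` lies in `𝔪`, so that `projM` is the identity on it. -/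
def IsAdInvariant (B : LinearMap.BilinForm ℝ S.m) : Prop :=
  ∀ Z ∈ subgroupLieAlgebra E H, ∀ X Y : S.m,
    B (S.projM ⁅Z, (X : GroupLieAlgebra 𝓘(ℝ, E) G)⁆) Y +
      B X (S.projM ⁅Z, (Y : GroupLieAlgebra 𝓘(ℝ, E) G)⁆) = 0

/-- `B(𝔤_γ, 𝔤_γ') = 0` for `γ ≠ γ'`. -/
def IsGradedOrthogonal (B : LinearMap.BilinForm ℝ S.m) : Prop :=
  ∀ γ γ' : Fin k → ZMod 2, γ ≠ γ' → ∀ X Y : S.m,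
    (X : GroupLieAlgebra 𝓘(ℝ, E) G) ∈ S.grade γ →
    (Y : GroupLieAlgebra 𝓘(ℝ, E) G) ∈ S.grade γ' → B X Y = 0

/-- The positive-definite symmetric `ad(H)`-invariant bilinear forms on `𝔪` for which the
components of the grading are pairwise orthogonal. -/
def invariantForms : Set (LinearMap.BilinForm ℝ S.m) :=
  {B | (∀ X Y, B X Y = B Y X) ∧ (∀ X, X ≠ 0 → 0 < B X X) ∧
    S.IsAdInvariant B ∧ S.IsGradedOrthogonal B}

end SymmetricStructure

end LieGroup

section HomogeneousSpace

variable {E : Type*} [NormedAddCommGroup E] [NormedSpace ℝ E]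
  {G : Type*} [TopologicalSpace G] [ChartedSpace E G] [Group G] {H : Subgroup G}
  {F : Type*} [NormedAddCommGroup F] [NormedSpace ℝ F]
  [ChartedSpace F (G ⧸ H)] [IsManifold 𝓘(ℝ, F) ∞ (G ⧸ H)]

/-- The smooth Riemannian metrics on the manifold `G ⧸ H`. -/
abbrev Metric (F : Type*) [NormedAddCommGroup F] [NormedSpace ℝ F] {G : Type*}
    [TopologicalSpace G] [Group G] (H : Subgroup G)
    [ChartedSpace F (G ⧸ H)] [IsManifold 𝓘(ℝ, F) ∞ (G ⧸ H)] :=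
  Bundle.ContMDiffRiemannianMetric 𝓘(ℝ, F) ∞ F
    (fun x : G ⧸ H => TangentSpace 𝓘(ℝ, F) x)

/-- The map `f` preserves the metric `g`: `g (df u, df v) = g (u, v)`. -/
def Preserves (g : Metric F H) (f : G ⧸ H → G ⧸ H) : Prop :=
  ∀ (y : G ⧸ H) (u v : TangentSpace 𝓘(ℝ, F) y),
    g.inner (f y) (mfderiv 𝓘(ℝ, F) 𝓘(ℝ, F) f y u) (mfderiv 𝓘(ℝ, F) 𝓘(ℝ, F) f y v) =
      g.inner y u v

/-- The metric `g` is `G`-invariant: the translations `y ↦ a • y` preserve it. -/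
def IsInvariant (g : Metric F H) : Prop :=
  ∀ a : G, Preserves g (fun y => a • y)

/-- The map `f` is the symmetry `s_{a,x}` of `G ⧸ H` at the point `x = g₀ H`, that is, the map
`g H ↦ g₀ s_a (g₀⁻¹ g) H`. -/
def IsSymmetryAt {k : ℕ} (S : SymmetricStructure E k H) (a : Fin k → ZMod 2) (x : G ⧸ H)
    (f : G ⧸ H → G ⧸ H) : Prop :=
  ∀ g₀ g : G, (g₀ : G ⧸ H) = x → f (g : G ⧸ H) = ((g₀ * S.symm a (g₀⁻¹ * g) : G) : G ⧸ H)

/-- The metric `g` is adapted to the `ℤ₂ᵏ`-symmetric structure: every symmetry `s_{a,x}` is a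
well-defined diffeomorphism of `G ⧸ H` and an isometry. -/
def IsAdapted {k : ℕ} (S : SymmetricStructure E k H) (g : Metric F H) : Prop :=
  ∀ (a : Fin k → ZMod 2) (x : G ⧸ H), ∃ f : Diffeomorph 𝓘(ℝ, F) 𝓘(ℝ, F) (G ⧸ H) (G ⧸ H) ∞,
    IsSymmetryAt S a x f ∧ Preserves g f

/-- The differential at `1` of the projection `G → G ⧸ H`, from `𝔤` to the tangent space of
`G ⧸ H` at the point `o = H`. -/
noncomputable def dproj (E F : Type*) [NormedAddCommGroup E] [NormedSpace ℝ E]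
    [NormedAddCommGroup F] [NormedSpace ℝ F]
    {G : Type*} [TopologicalSpace G] [ChartedSpace E G] [Group G] (H : Subgroup G)
    [ChartedSpace F (G ⧸ H)] :
    GroupLieAlgebra 𝓘(ℝ, E) G →L[ℝ] TangentSpace 𝓘(ℝ, F) ((1 : G) : G ⧸ H) :=
  mfderiv 𝓘(ℝ, E) 𝓘(ℝ, F) (fun g : G => (g : G ⧸ H)) (1 : G)

/-- The bilinear form `B(X,Y) = g(X,Y)_o` on `𝔪`, where `X, Y ∈ 𝔪` are viewed as tangent vectors
of `G ⧸ H` at `o`. -/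
noncomputable def formOf {k : ℕ} (S : SymmetricStructure E k H) (g : Metric F H) :
    LinearMap.BilinForm ℝ S.m :=
  LinearMap.mk₂ ℝ (fun X Y => g.inner ((1 : G) : G ⧸ H) (dproj E F H X) (dproj E F H Y))
    (by intros; simp) (by intros; simp) (by intros; simp) (by intros; simp)

end HomogeneousSpace

end Z2kSymmetric

/-!
The geometry is carried by the differential `dπ` of the projection `π : G → G ⧸ H` at `1`. As `π` is
a submersion, `dπ` is onto, and its kernel is the Lie algebra `𝔥` of `H`
(`mem_subgroupLieAlgebra_iff`), so that it identifies `𝔪` with the tangent space of `G ⧸ H` at the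
base point `o`. Under this identification `Ad h` corresponds to the differential at `o` of the
translation by `h ∈ H` (`modelDeriv_mk_adjointOrbit`).

An invariant metric is determined by its value at `o`, and a scalar product at `o` extends to an
invariant metric if and only if the translations by `H` preserve it: the extension transports the
scalar product by the inverse of any element of the coset, and it is smooth because these elements
can be chosen as the values of a smooth local section of `π` (`contMDiff_transportedForm`). The
invariance under `H` is equivalent to its infinitesimal form. One direction differentiates along
curves in `H`, using that the derivative of `Ad` at `1` is the bracket of left invariant vector
fields (`modelDeriv_adjointOrbit`). The other one uses that `H` is connected: a function on `G`
whose derivative along `H` vanishes at all points of `H` is constant on `H`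
(`eq_of_modelDeriv_eq_zero_on_subgroup`).

The same principle, applied to `x⁻¹ * s_a x`, shows that the automorphisms `s_a` fix `H` pointwise,
since `σ_a` is the identity on `𝔤_e = 𝔥`. They therefore induce diffeomorphisms of `G ⧸ H`, whose
translates are the symmetries. At `o` the symmetry multiplies `B(X, Y)`, for `X ∈ 𝔤_γ` and
`Y ∈ 𝔤_γ'`, by the product of the values of a character at `γ` and `γ'`. As the characters of `ℤ₂ᵏ`
separate points, the metric is adapted if and only if the components of the grading in `𝔪` are
orthogonal.

The map `U` exists and is unique because a scalar product on a finite dimensional space identifies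
it with its dual (`existsUnique_koszul`).
-/

namespace Z2kSymmetric

/-! ### The second derivative of a multiplication in coordinates -/

section LocalCalculus

open Filter Topology ContinuousLinearMap

variable {E : Type*} [NormedAddCommGroup E] [NormedSpace ℝ E]

/-- Let `μ` be a multiplication read in coordinates, with neutral element `e`, and let `a` be the
orbit of `X` under the adjoint representation, which is characterized by
`D₁μ(e, u) (a u) = D₂μ(u, e) X`. Then `a` is differentiable at `e`, and its derivative is the
antisymmetrized mixed second derivative of `μ`, that is, the Lie bracket. -/
theorem hasFDerivAt_of_partial_relation [CompleteSpace E] {μ : E × E → E} {e X : E}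
    (hμ : ContDiffAt ℝ 2 μ (e, e)) {a : E → E}
    (hid : (fderiv ℝ μ (e, e)).comp (inl ℝ E E) = ContinuousLinearMap.id ℝ E)
    (ha : a e = X)
    (hrel : ∀ᶠ u in 𝓝 e, fderiv ℝ μ (e, u) (a u, 0) = fderiv ℝ μ (u, e) (0, X)) :
    DifferentiableAt ℝ a e ∧ ∀ Z, fderiv ℝ a e Z =
      fderiv ℝ (fderiv ℝ μ) (e, e) (Z, 0) (0, X) -
      fderiv ℝ (fderiv ℝ μ) (e, e) (X, 0) (0, Z) := by
  have hsymm : IsSymmSndFDerivAt ℝ μ (e, e) := hμ.isSymmSndFDerivAt (by simp)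
  have hD : HasFDerivAt (fderiv ℝ μ) (fderiv ℝ (fderiv ℝ μ) (e, e)) (e, e) :=
    ((hμ.fderiv_right (m := 1) (by norm_num)).differentiableAt (by norm_num)).hasFDerivAt
  set D := fderiv ℝ (fderiv ℝ μ) (e, e)
  have hM : HasFDerivAt (fun u => fderiv ℝ μ (e, u)) (D.comp (inr ℝ E E)) e := by
    have := HasFDerivAt.comp (g := fderiv ℝ μ) (f := fun u : E => (e, u)) e hD
      (hasFDerivAt_prodMk_right e e)
    exact this
  have hN : HasFDerivAt (fun u => fderiv ℝ μ (u, e)) (D.comp (inl ℝ E E)) e := by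
    have := HasFDerivAt.comp (g := fderiv ℝ μ) (f := fun u : E => (u, e)) e hD
      (hasFDerivAt_prodMk_left e e)
    exact this
  have hM' : DifferentiableAt ℝ (fun u => (fderiv ℝ μ (e, u)).comp (inl ℝ E E)) e :=
    hM.differentiableAt.clm_comp (differentiableAt_const _)
  have hN' : DifferentiableAt ℝ (fun u => fderiv ℝ μ (u, e) (0, X)) e :=
    hN.differentiableAt.clm_apply (differentiableAt_const _)
  have hinv : DifferentiableAt ℝ
      (fun u => ((fderiv ℝ μ (e, u)).comp (inl ℝ E E)).inverse) e := by
    have h1 : DifferentiableAt ℝ (inverse : (E →L[ℝ] E) → (E →L[ℝ] E))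
        ((fderiv ℝ μ (e, e)).comp (inl ℝ E E)) := by
      rw [hid]
      exact (contDiffAt_map_inverse (n := 1) (ContinuousLinearEquiv.refl ℝ E)).differentiableAt
        (by norm_num)
    exact DifferentiableAt.comp (g := (inverse : (E →L[ℝ] E) → (E →L[ℝ] E))) e h1 hM'
  have hunit : ∀ᶠ u in 𝓝 e, ((fderiv ℝ μ (e, u)).comp (inl ℝ E E)).IsInvertible := by
    have h1 := (ContinuousLinearEquiv.nhds (ContinuousLinearEquiv.refl ℝ E))
    have h2 : Tendsto (fun u => (fderiv ℝ μ (e, u)).comp (inl ℝ E E)) (𝓝 e)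
        (𝓝 ((ContinuousLinearEquiv.refl ℝ E : E ≃L[ℝ] E) : E →L[ℝ] E)) := by
      have := hM'.continuousAt.tendsto
      rwa [hid] at this
    exact h2 h1
  -- Near `e` the relation can be solved for `a`, which shows that `a` is differentiable.
  have haeq : a =ᶠ[𝓝 e] fun u => ((fderiv ℝ μ (e, u)).comp (inl ℝ E E)).inverse
      (fderiv ℝ μ (u, e) (0, X)) := by
    filter_upwards [hunit, hrel] with u hu hr
    obtain ⟨A, hA⟩ := hu
    rw [← hr, ← hA, inverse_equiv]
    have : fderiv ℝ μ (e, u) (a u, 0) = (A : E →L[ℝ] E) (a u) := by rw [hA]; rfl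
    rw [this]
    simp
  have hadiff : DifferentiableAt ℝ a e :=
    (hinv.clm_apply hN').congr_of_eventuallyEq haeq
  refine ⟨hadiff, fun Z => ?_⟩
  -- Both sides of the relation are differentiated at `e`.
  have h1 : HasFDerivAt (fun u => fderiv ℝ μ (e, u) (a u, (0 : E))) _ e :=
    hM.clm_apply (hadiff.hasFDerivAt.prodMk (hasFDerivAt_const (0 : E) e))
  have h2 : HasFDerivAt (fun u => fderiv ℝ μ (u, e) ((0 : E), X)) _ e :=
    hN.clm_apply (hasFDerivAt_const ((0 : E), X) e)
  have h3 := (h1.congr_of_eventuallyEq (hrel.mono fun u h => h.symm)).unique h2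
  have h4 := DFunLike.congr_fun h3 Z
  have hidZ : fderiv ℝ μ (e, e) (fderiv ℝ a e Z, 0) = fderiv ℝ a e Z :=
    DFunLike.congr_fun hid (fderiv ℝ a e Z)
  simp [ha, hidZ] at h4
  have h5 := hsymm (X, 0) (0, Z)
  rw [h5, ← h4]
  simp [D]

end LocalCalculus

/-! ### Derivatives of maps of manifolds between the model spaces -/

section ModelDeriv

open Filter Topology

variable (E : Type*) [NormedAddCommGroup E] [NormedSpace ℝ E]
  (F : Type*) [NormedAddCommGroup F] [NormedSpace ℝ F]
  (F' : Type*) [NormedAddCommGroup F'] [NormedSpace ℝ F']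
  {M : Type*} [TopologicalSpace M] [ChartedSpace E M]
  {N : Type*} [TopologicalSpace N] [ChartedSpace F N]
  {P : Type*} [TopologicalSpace P] [ChartedSpace F' P]

/-- The manifold derivative of `f` at `x`, as a map between the model vector spaces. All tangent
spaces of a manifold are copies of its model space; with this type the derivatives at `x` of maps
whose values at `x` agree only propositionally can be compared. -/
noncomputable def modelDeriv (f : M → N) (x : M) : E →L[ℝ] F :=
  mfderiv 𝓘(ℝ, E) 𝓘(ℝ, F) f x

variable {E F F'}

theorem mdifferentiableAt_comp {g : N → P} {f : M → N} {x : M} {y : N}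
    (hg : MDifferentiableAt 𝓘(ℝ, F) 𝓘(ℝ, F') g y) (hf : MDifferentiableAt 𝓘(ℝ, E) 𝓘(ℝ, F) f x)
    (hy : f x = y) : MDifferentiableAt 𝓘(ℝ, E) 𝓘(ℝ, F') (fun z => g (f z)) x := by
  subst hy
  exact hg.comp x hf

theorem modelDeriv_comp {g : N → P} {f : M → N} {x : M} {y : N}
    (hg : MDifferentiableAt 𝓘(ℝ, F) 𝓘(ℝ, F') g y) (hf : MDifferentiableAt 𝓘(ℝ, E) 𝓘(ℝ, F) f x)
    (hy : f x = y) :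
    modelDeriv E F' (fun z => g (f z)) x = (modelDeriv F F' g y).comp (modelDeriv E F f x) := by
  subst hy
  exact mfderiv_comp x hg hf

theorem modelDeriv_comp_apply {g : N → P} {f : M → N} {x : M} {y : N}
    (hg : MDifferentiableAt 𝓘(ℝ, F) 𝓘(ℝ, F') g y) (hf : MDifferentiableAt 𝓘(ℝ, E) 𝓘(ℝ, F) f x)
    (hy : f x = y) (v : E) :
    modelDeriv E F' (fun z => g (f z)) x v = modelDeriv F F' g y (modelDeriv E F f x v) := by
  rw [modelDeriv_comp hg hf hy]; rfl

@[simp]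
theorem modelDeriv_id (x : M) : modelDeriv E E (fun y : M => y) x = ContinuousLinearMap.id ℝ E :=
  mfderiv_id

@[simp]
theorem modelDeriv_const (x : M) (c : N) : modelDeriv E F (fun _ : M => c) x = 0 :=
  mfderiv_const

theorem modelDeriv_congr {f g : M → N} {x : M} (h : f =ᶠ[𝓝 x] g) :
    modelDeriv E F f x = modelDeriv E F g x :=
  h.mfderiv_eq

theorem modelDeriv_eq_fderiv (f : E → F) (x : E) : modelDeriv E F f x = fderiv ℝ f x :=
  mfderiv_eq_fderiv

theorem modelDeriv_extChartAt_self [IsManifold 𝓘(ℝ, E) 1 M] (x : M) :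
    modelDeriv E E (extChartAt 𝓘(ℝ, E) x) x = ContinuousLinearMap.id ℝ E :=
  mfderiv_extChartAt_self

theorem mdifferentiableAt_extChartAt_symm [IsManifold 𝓘(ℝ, E) 1 M] (x : M) {u : E}
    (hu : u ∈ (extChartAt 𝓘(ℝ, E) x).target) :
    MDifferentiableAt 𝓘(ℝ, E) 𝓘(ℝ, E) (extChartAt 𝓘(ℝ, E) x).symm u := by
  have h := mdifferentiableWithinAt_extChartAt_symm (I := 𝓘(ℝ, E)) hu
  rwa [modelWithCornersSelf_coe, Set.range_id, mdifferentiableWithinAt_univ] at h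

theorem modelDeriv_extChartAt_comp_symm [IsManifold 𝓘(ℝ, E) 1 M] (x : M) {u : E}
    (hu : u ∈ (extChartAt 𝓘(ℝ, E) x).target) :
    (modelDeriv E E (extChartAt 𝓘(ℝ, E) x) ((extChartAt 𝓘(ℝ, E) x).symm u)).comp
      (modelDeriv E E (extChartAt 𝓘(ℝ, E) x).symm u) = ContinuousLinearMap.id ℝ E := by
  rw [← modelDeriv_comp (mdifferentiableAt_extChartAt
    (by simpa using (extChartAt 𝓘(ℝ, E) x).map_target hu))
    (mdifferentiableAt_extChartAt_symm x hu) rfl, ← modelDeriv_id (E := E) u]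
  apply modelDeriv_congr
  filter_upwards [(isOpen_extChartAt_target (I := 𝓘(ℝ, E)) x).mem_nhds hu] with v hv
  exact (extChartAt 𝓘(ℝ, E) x).right_inv hv

theorem modelDeriv_extChartAt_symm_self [IsManifold 𝓘(ℝ, E) 1 M] (x : M) :
    modelDeriv E E (extChartAt 𝓘(ℝ, E) x).symm (extChartAt 𝓘(ℝ, E) x x) =
      ContinuousLinearMap.id ℝ E := by
  have h := modelDeriv_extChartAt_comp_symm (E := E) x (mem_extChartAt_target x)
  rwa [extChartAt_to_inv, modelDeriv_extChartAt_self, ContinuousLinearMap.id_comp] at h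

/-- At the base point of the chart the manifold derivative is the derivative in the chart. -/
theorem hasFDerivAt_comp_extChartAt_symm [IsManifold 𝓘(ℝ, E) 1 M] {f : M → F} {x : M}
    (hf : MDifferentiableAt 𝓘(ℝ, E) 𝓘(ℝ, F) f x) :
    HasFDerivAt (fun u => f ((extChartAt 𝓘(ℝ, E) x).symm u)) (modelDeriv E F f x)
      (extChartAt 𝓘(ℝ, E) x x) := by
  have h1 := mdifferentiableAt_extChartAt_symm x (mem_extChartAt_target (I := 𝓘(ℝ, E)) x)
  have h2 : MDifferentiableAt 𝓘(ℝ, E) 𝓘(ℝ, F) (fun u => f ((extChartAt 𝓘(ℝ, E) x).symm u))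
      (extChartAt 𝓘(ℝ, E) x x) :=
    mdifferentiableAt_comp hf h1 (extChartAt_to_inv x)
  have h3 := modelDeriv_comp hf h1 (extChartAt_to_inv x)
  rw [modelDeriv_extChartAt_symm_self, ContinuousLinearMap.comp_id, modelDeriv_eq_fderiv] at h3
  rw [← h3]
  exact h2.differentiableAt.hasFDerivAt

end ModelDeriv

/-! ### The derivative of the adjoint representation -/

section Adjoint

open Filter Topology ContinuousLinearMap VectorField

variable {E : Type*} [NormedAddCommGroup E] [NormedSpace ℝ E]
  {G : Type*} [TopologicalSpace G] [ChartedSpace E G] [Group G]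

variable (E) in
/-- The multiplication of `G` read in the preferred chart at `1`. -/
noncomputable def chartMul (G : Type*) [TopologicalSpace G] [ChartedSpace E G] [Group G]
    (p : E × E) : E :=
  extChartAt 𝓘(ℝ, E) (1 : G) ((extChartAt 𝓘(ℝ, E) (1 : G)).symm p.1 *
    (extChartAt 𝓘(ℝ, E) (1 : G)).symm p.2)

/-- The orbit map `g ↦ Ad g X` of the adjoint representation, with values in the model space. -/
noncomputable def adjointOrbit (E : Type*) [NormedAddCommGroup E] [NormedSpace ℝ E]
    {G : Type*} [TopologicalSpace G] [ChartedSpace E G] [Group G] (X : E) (g : G) : E :=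
  modelDeriv E E (fun x => g * x * g⁻¹) (1 : G) X

/-- The Lie bracket of the Lie algebra of `G`, as an operation on the model space. -/
noncomputable def modelBracket (E : Type*) [NormedAddCommGroup E] [NormedSpace ℝ E]
    (G : Type*) [TopologicalSpace G] [ChartedSpace E G] [Group G] (X Y : E) : E :=
  Bracket.bracket (L := GroupLieAlgebra 𝓘(ℝ, E) G) (M := GroupLieAlgebra 𝓘(ℝ, E) G) X Y

theorem adjointOrbit_one (X : E) : adjointOrbit E X (1 : G) = X := by
  have h : (fun x : G => 1 * x * 1⁻¹) = fun x => x := by ext; simp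
  simp only [adjointOrbit, h, modelDeriv_id]
  rfl

variable [LieGroup 𝓘(ℝ, E) ∞ G]

local notation "φ" => extChartAt 𝓘(ℝ, E) (1 : G)

theorem contMDiffAt_extChartAt_symm_of_mem {M : Type*} [TopologicalSpace M] [ChartedSpace E M]
    [IsManifold 𝓘(ℝ, E) ∞ M] (x : M) {u : E} (hu : u ∈ (extChartAt 𝓘(ℝ, E) x).target) :
    ContMDiffAt 𝓘(ℝ, E) 𝓘(ℝ, E) ∞ (extChartAt 𝓘(ℝ, E) x).symm u :=
  (contMDiffOn_extChartAt_symm x).contMDiffAt ((isOpen_extChartAt_target x).mem_nhds hu)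

theorem contDiffAt_chartMul {u v : E} (hu : u ∈ (φ).target) (hv : v ∈ (φ).target)
    (huv : (φ).symm u * (φ).symm v ∈ (φ).source) : ContDiffAt ℝ ∞ (chartMul E G) (u, v) := by
  rw [← contMDiffAt_iff_contDiffAt]
  have h1 : ContMDiffAt 𝓘(ℝ, E × E) 𝓘(ℝ, E) ∞ (fun p : E × E => (φ).symm p.1 * (φ).symm p.2)
      (u, v) := by
    apply ContMDiffAt.mul
    · exact (contMDiffAt_extChartAt_symm_of_mem (1 : G) hu).comp (u, v)
        (contDiff_fst.contMDiff.contMDiffAt)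
    · exact (contMDiffAt_extChartAt_symm_of_mem (1 : G) hv).comp (u, v)
        (contDiff_snd.contMDiff.contMDiffAt)
  exact (contMDiffAt_extChartAt' (by simpa using huv)).comp (u, v) h1

theorem mdifferentiableAt_mul_left (g x : G) :
    MDifferentiableAt 𝓘(ℝ, E) 𝓘(ℝ, E) (fun y => g * y) x :=
  ((contMDiff_mul_left (I := 𝓘(ℝ, E)) (n := ∞)).contMDiffAt).mdifferentiableAt (by simp)

theorem mdifferentiableAt_mul_right (g x : G) :
    MDifferentiableAt 𝓘(ℝ, E) 𝓘(ℝ, E) (fun y => y * g) x :=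
  ((contMDiff_mul_right (I := 𝓘(ℝ, E)) (n := ∞)).contMDiffAt).mdifferentiableAt (by simp)

theorem mdifferentiableAt_conj (g x : G) :
    MDifferentiableAt 𝓘(ℝ, E) 𝓘(ℝ, E) (fun y : G => g * y * g⁻¹) x := by
  have : ContMDiff 𝓘(ℝ, E) 𝓘(ℝ, E) ∞ (fun y : G => g * y * g⁻¹) :=
    (contMDiff_const.mul contMDiff_id).mul contMDiff_const
  exact this.contMDiffAt.mdifferentiableAt (by simp)

/-- In the chart at `1` a left invariant vector field is a partial derivative of the
multiplication. -/
theorem mpullbackWithin_mulInvariantVectorField (X : GroupLieAlgebra 𝓘(ℝ, E) G) {u : E}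
    (hu : u ∈ (φ).target) :
    mpullbackWithin 𝓘(ℝ, E) 𝓘(ℝ, E) (φ).symm (mulInvariantVectorField X)
      (Set.range 𝓘(ℝ, E)) u = fderiv ℝ (chartMul E G) (u, φ 1) ((0 : E), (X : E)) := by
  have h1 := mfderivWithin_extChartAt_symm_comp_mfderiv_extChartAt (I := 𝓘(ℝ, E)) hu
  have h2 := mfderiv_extChartAt_comp_mfderivWithin_extChartAt_symm (I := 𝓘(ℝ, E)) hu
  rw [mpullbackWithin_apply, ContinuousLinearMap.inverse_eq h1 h2]
  have hsrc : (φ).symm u ∈ (φ).source := (φ).map_target hu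
  have h3 : MDifferentiableAt 𝓘(ℝ, E) 𝓘(ℝ, E) (φ) ((φ).symm u) :=
    mdifferentiableAt_extChartAt (by simpa using hsrc)
  have h3' : MDifferentiableAt 𝓘(ℝ, E) 𝓘(ℝ, E) (fun y => φ ((φ).symm u * y)) (1 : G) :=
    mdifferentiableAt_comp h3 (mdifferentiableAt_mul_left _ _) (mul_one _)
  have h4 := modelDeriv_comp_apply h3 (mdifferentiableAt_mul_left _ (1 : G)) (mul_one _) X
  have h5 := hasFDerivAt_comp_extChartAt_symm h3'
  have he : (φ).symm (φ 1) = 1 := extChartAt_to_inv (I := 𝓘(ℝ, E)) (1 : G)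
  have h6 : HasFDerivAt (chartMul E G) (fderiv ℝ (chartMul E G) (u, φ 1)) (u, φ 1) :=
    ((contDiffAt_chartMul hu (mem_extChartAt_target 1)
      (by rw [he, mul_one]; exact hsrc)).differentiableAt (by simp)).hasFDerivAt
  -- Both `h5` and `h7` compute the derivative at `φ 1` of `v ↦ φ (φ⁻¹ u * φ⁻¹ v)`.
  have h7 := HasFDerivAt.comp (g := chartMul E G) (f := fun v : E => (u, v)) (φ 1) h6
    (hasFDerivAt_prodMk_right u (φ 1))
  exact h4.symm.trans (DFunLike.congr_fun (h5.unique h7) (X : E))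

/-- The relation `g x = (g x g⁻¹) g`, differentiated in `x` at `1` and read in the chart. -/
theorem fderiv_chartMul_adjointOrbit (X : E) :
    ∀ᶠ u in 𝓝 (φ 1), fderiv ℝ (chartMul E G) (φ 1, u)
      (adjointOrbit E X ((φ).symm u), (0 : E)) =
      fderiv ℝ (chartMul E G) (u, φ 1) ((0 : E), X) := by
  have he : (φ).symm (φ 1) = 1 := extChartAt_to_inv (I := 𝓘(ℝ, E)) (1 : G)
  filter_upwards [extChartAt_target_mem_nhds (I := 𝓘(ℝ, E)) (1 : G)] with u hu
  have hsrc : (φ).symm u ∈ (φ).source := (φ).map_target hu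
  set g := (φ).symm u with hg
  have hφ : MDifferentiableAt 𝓘(ℝ, E) 𝓘(ℝ, E) (φ) (1 : G) :=
    mdifferentiableAt_extChartAt (by simp)
  have hg1 : g * 1 * g⁻¹ = 1 := by group
  have h1 := hasFDerivAt_comp_extChartAt_symm
    (mdifferentiableAt_comp hφ (mdifferentiableAt_conj g 1) hg1)
  rw [modelDeriv_comp hφ (mdifferentiableAt_conj g 1) hg1, modelDeriv_extChartAt_self,
    ContinuousLinearMap.id_comp] at h1
  have h2 : HasFDerivAt (chartMul E G) (fderiv ℝ (chartMul E G) (φ 1, u)) (φ 1, u) :=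
    ((contDiffAt_chartMul (mem_extChartAt_target 1) hu
      (by rw [he, one_mul]; exact hsrc)).differentiableAt (by simp)).hasFDerivAt
  have h3 : HasFDerivAt (chartMul E G) (fderiv ℝ (chartMul E G) (u, φ 1)) (u, φ 1) :=
    ((contDiffAt_chartMul hu (mem_extChartAt_target 1)
      (by rw [he, mul_one]; exact hsrc)).differentiableAt (by simp)).hasFDerivAt
  have hval : φ (g * (φ).symm (φ 1) * g⁻¹) = φ 1 := by
    rw [he]; simp
  have h4 := HasFDerivAt.comp (g := chartMul E G)
    (f := fun v : E => (φ (g * (φ).symm v * g⁻¹), u)) (φ 1)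
    (by rw [hval]; exact h2) (h1.prodMk (hasFDerivAt_const u (φ 1)))
  have h5 := HasFDerivAt.comp (g := chartMul E G) (f := fun v : E => (u, v)) (φ 1) h3
    (hasFDerivAt_prodMk_right u (φ 1))
  have h6 : (chartMul E G ∘ fun v : E => (φ (g * (φ).symm v * g⁻¹), u)) =ᶠ[𝓝 (φ 1)]
      (chartMul E G ∘ fun v : E => (u, v)) := by
    have hcont : ContinuousAt (fun v : E => g * (φ).symm v * g⁻¹) (φ 1) := by
      refine ContinuousAt.comp (g := fun x => g * x * g⁻¹) ?_
        (continuousAt_extChartAt_symm (I := 𝓘(ℝ, E)) (1 : G))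
      exact (mdifferentiableAt_conj (E := E) g _).continuousAt
    have hmem : ∀ᶠ v in 𝓝 (φ 1), g * (φ).symm v * g⁻¹ ∈ (φ).source := by
      apply hcont.eventually_mem
      rw [he, hg1]
      exact extChartAt_source_mem_nhds (I := 𝓘(ℝ, E)) (1 : G)
    filter_upwards [hmem] with v hv
    simp only [chartMul, Function.comp_apply]
    rw [(φ).left_inv hv, ← hg]
    simp
  have h7 := h4.unique (h5.congr_of_eventuallyEq h6)
  exact DFunLike.congr_fun h7 X

/-- The derivative of the adjoint representation is the bracket: in the chart at `1` both sides are
the antisymmetrized mixed second derivative of the multiplication. -/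
theorem modelDeriv_adjointOrbit [CompleteSpace E] (X : E) :
    MDifferentiableAt 𝓘(ℝ, E) 𝓘(ℝ, E) (adjointOrbit E X : G → E) 1 ∧
    ∀ Z : E, modelDeriv E E (adjointOrbit E X : G → E) 1 Z = modelBracket E G Z X := by
  have he : (φ).symm (φ 1) = 1 := extChartAt_to_inv (I := 𝓘(ℝ, E)) (1 : G)
  have hμ : ContDiffAt ℝ ∞ (chartMul E G) (φ 1, φ 1) :=
    contDiffAt_chartMul (mem_extChartAt_target 1) (mem_extChartAt_target 1) (by rw [he]; simp)
  have hid : (fderiv ℝ (chartMul E G) (φ 1, φ 1)).comp (inl ℝ E E) =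
      ContinuousLinearMap.id ℝ E := by
    have h5 := HasFDerivAt.comp (g := chartMul E G) (f := fun v : E => (v, φ 1)) (φ 1)
      (hμ.differentiableAt (by simp)).hasFDerivAt
      (hasFDerivAt_prodMk_left (φ 1) (φ 1))
    refine h5.unique ((hasFDerivAt_id (φ 1)).congr_of_eventuallyEq ?_)
    filter_upwards [extChartAt_target_mem_nhds (I := 𝓘(ℝ, E)) (1 : G)] with u hu
    simp only [chartMul, Function.comp_apply, he, mul_one, (φ).right_inv hu, id]
  have ha1 : adjointOrbit E X ((φ).symm (φ 1)) = (X : E) := by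
    rw [he]
    exact adjointOrbit_one _
  have key := hasFDerivAt_of_partial_relation (E := E) (X := X)
    (a := fun u => adjointOrbit E X ((φ).symm u)) (hμ.of_le (by norm_cast)) hid ha1
    (fderiv_chartMul_adjointOrbit (E := E) (G := G) X)
  have hloc : (adjointOrbit E X : G → E) =ᶠ[𝓝 1] fun g => adjointOrbit E X ((φ).symm (φ g)) := by
    filter_upwards [extChartAt_source_mem_nhds (I := 𝓘(ℝ, E)) (1 : G)] with g hg
    rw [(φ).left_inv hg]
  have hφ : MDifferentiableAt 𝓘(ℝ, E) 𝓘(ℝ, E) (φ) (1 : G) :=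
    mdifferentiableAt_extChartAt (by simp)
  have hcomp : MDifferentiableAt 𝓘(ℝ, E) 𝓘(ℝ, E) (adjointOrbit E X : G → E) 1 :=
    (mdifferentiableAt_comp (g := fun u => adjointOrbit E X ((φ).symm u)) (f := φ) (x := (1 : G))
      key.1.mdifferentiableAt hφ rfl).congr_of_eventuallyEq hloc
  refine ⟨hcomp, fun Z => ?_⟩
  have h1 := (hasFDerivAt_comp_extChartAt_symm hcomp).fderiv
  have hD : HasFDerivAt (fderiv ℝ (chartMul E G)) (fderiv ℝ (fderiv ℝ (chartMul E G)) (φ 1, φ 1))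
      (φ 1, φ 1) :=
    ((hμ.fderiv_right (m := 1) (by norm_cast)).differentiableAt (by norm_num)).hasFDerivAt
  have hN : ∀ Y W : E, fderiv ℝ (fun u => fderiv ℝ (chartMul E G) (u, φ 1) (0, Y)) (φ 1) W =
      fderiv ℝ (fderiv ℝ (chartMul E G)) (φ 1, φ 1) (W, 0) (0, Y) := by
    intro Y W
    have h2 := (HasFDerivAt.comp (g := fderiv ℝ (chartMul E G)) (f := fun u : E => (u, φ 1)) (φ 1)
      hD (hasFDerivAt_prodMk_left (φ 1) (φ 1))).clm_apply (hasFDerivAt_const ((0 : E), Y) (φ 1))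
    have h3 := DFunLike.congr_fun h2.fderiv W
    simpa using h3
  have hpull : ∀ Y : GroupLieAlgebra 𝓘(ℝ, E) G,
      mpullbackWithin 𝓘(ℝ, E) 𝓘(ℝ, E) (φ).symm (mulInvariantVectorField Y)
        (Set.range 𝓘(ℝ, E)) =ᶠ[𝓝 (φ 1)]
        fun u => fderiv ℝ (chartMul E G) (u, φ 1) ((0 : E), (Y : E)) := by
    intro Y
    filter_upwards [extChartAt_target_mem_nhds (I := 𝓘(ℝ, E)) (1 : G)] with u hu
    exact mpullbackWithin_mulInvariantVectorField Y hu
  have hone : ∀ Y : E, fderiv ℝ (chartMul E G) (φ 1, φ 1) ((0 : E), Y) = Y := by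
    intro Y
    have h5 := HasFDerivAt.comp (g := chartMul E G) (f := fun v : E => (φ 1, v)) (φ 1)
      (hμ.differentiableAt (by simp)).hasFDerivAt
      (hasFDerivAt_prodMk_right (φ 1) (φ 1))
    refine DFunLike.congr_fun
      (h5.unique ((hasFDerivAt_id (φ 1)).congr_of_eventuallyEq ?_)) Y
    filter_upwards [extChartAt_target_mem_nhds (I := 𝓘(ℝ, E)) (1 : G)] with u hu
    simp only [chartMul, Function.comp_apply, he, one_mul, (φ).right_inv hu, id]
  -- The two terms of the bracket of left invariant vector fields in the chart.
  have hbr : ∀ Y W : GroupLieAlgebra 𝓘(ℝ, E) G, fderiv ℝ (E := E) (F := E)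
      (mpullbackWithin 𝓘(ℝ, E) 𝓘(ℝ, E) (φ).symm (mulInvariantVectorField Y)
        (Set.range 𝓘(ℝ, E))) (φ 1)
      (mpullbackWithin 𝓘(ℝ, E) 𝓘(ℝ, E) (φ).symm (mulInvariantVectorField W)
        (Set.range 𝓘(ℝ, E)) (φ 1)) =
      fderiv ℝ (fderiv ℝ (chartMul E G)) (φ 1, φ 1) ((W : E), 0) (0, (Y : E)) := by
    intro Y W
    have e1 : mpullbackWithin 𝓘(ℝ, E) 𝓘(ℝ, E) (φ).symm (mulInvariantVectorField W)
        (Set.range 𝓘(ℝ, E)) (φ 1) = (W : E) :=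
      ((hpull W).eq_of_nhds).trans (hone W)
    exact ((congrArg _ e1).trans (DFunLike.congr_fun (hpull Y).fderiv_eq (W : E))).trans (hN Y W)
  have e2 := hbr X Z
  have e3 := hbr Z X
  have hi : (mfderiv 𝓘(ℝ, E) 𝓘(ℝ, E) (φ) (1 : G)).inverse = ContinuousLinearMap.id ℝ E :=
    (congrArg (fun L : E →L[ℝ] E => L.inverse) (modelDeriv_extChartAt_self (E := E) (1 : G))).trans
      ContinuousLinearMap.inverse_id
  have h0 : modelBracket E G Z X = mlieBracketWithin 𝓘(ℝ, E)
      (mulInvariantVectorField (I := 𝓘(ℝ, E)) (G := G) Z)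
      (mulInvariantVectorField (I := 𝓘(ℝ, E)) (G := G) X) Set.univ (1 : G) := rfl
  refine Eq.trans ?_ h0.symm
  rw [mlieBracketWithin_apply]
  refine Eq.trans ?_ (DFunLike.congr_fun hi _).symm
  simp only [Set.preimage_univ, Set.univ_inter]
  simp only [modelWithCornersSelf_coe, Set.range_id] at e2 e3 ⊢
  have hl := congrFun (lieBracketWithin_univ (𝕜 := ℝ) (E := E)
    (V := mpullbackWithin 𝓘(ℝ, E) 𝓘(ℝ, E) (φ).symm (mulInvariantVectorField Z) Set.univ)
    (W := mpullbackWithin 𝓘(ℝ, E) 𝓘(ℝ, E) (φ).symm (mulInvariantVectorField X) Set.univ)) (φ 1)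
  exact (DFunLike.congr_fun h1 (Z : E)).symm.trans
    ((key.2 Z).trans ((congrArg₂ (fun a b : E => a - b) e2 e3).symm.trans hl.symm))

end Adjoint

/-! ### Local structure of submersions -/

section Submersion

open Filter Topology IsManifold

variable {E : Type*} [NormedAddCommGroup E] [NormedSpace ℝ E]
  {F : Type*} [NormedAddCommGroup F] [NormedSpace ℝ F]
  {M : Type*} [TopologicalSpace M] [ChartedSpace E M]
  {N : Type*} [TopologicalSpace N] [ChartedSpace F N]

/-- In suitable charts a submersion is a linear projection `L`, which has a linear section `R`. -/
theorem exists_chart_of_isSubmersionAt {f : M → N} {x : M}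
    (hf : Manifold.IsSubmersionAt 𝓘(ℝ, E) 𝓘(ℝ, F) ∞ f x) :
    ∃ (φ : OpenPartialHomeomorph M E) (ψ : OpenPartialHomeomorph N F) (L : E →L[ℝ] F)
      (R : F →L[ℝ] E), φ ∈ maximalAtlas 𝓘(ℝ, E) ∞ M ∧ ψ ∈ maximalAtlas 𝓘(ℝ, F) ∞ N ∧
      x ∈ φ.source ∧ (∀ y ∈ φ.source, f y ∈ ψ.source) ∧ (∀ y ∈ φ.source, ψ (f y) = L (φ y)) ∧
      ∀ w, L (R w) = w := by
  refine ⟨hf.domChart, hf.codChart, (ContinuousLinearMap.fst ℝ F hf.complement).comp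
    (hf.equiv : E →L[ℝ] F × hf.complement), (hf.equiv.symm : F × hf.complement →L[ℝ] E).comp
    (ContinuousLinearMap.inl ℝ F hf.complement), hf.domChart_mem_maximalAtlas,
    hf.codChart_mem_maximalAtlas, hf.mem_domChart_source,
    fun y hy => hf.source_subset_preimage_source hy, fun y hy => ?_, fun w => by simp⟩
  have h := hf.writtenInCharts (show hf.domChart y ∈ (hf.domChart.extend 𝓘(ℝ, E)).target by
    simpa using hf.domChart.map_source hy)
  simpa [hf.domChart.left_inv hy] using h

/-- A submersion has local sections through every point. -/
theorem exists_localSection {f : M → N} {x : M}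
    (hf : Manifold.IsSubmersionAt 𝓘(ℝ, E) 𝓘(ℝ, F) ∞ f x) :
    ∃ σ : N → M, σ (f x) = x ∧ ContMDiffAt 𝓘(ℝ, F) 𝓘(ℝ, E) ∞ σ (f x) ∧
      ∀ᶠ y in 𝓝 (f x), f (σ y) = y := by
  obtain ⟨φ, ψ, L, R, hφ, hψ, hx, hmap, hL, hR⟩ := exists_chart_of_isSubmersionAt hf
  have hval : φ x + R (ψ (f x) - ψ (f x)) = φ x := by simp
  have hcd : ContMDiffAt 𝓘(ℝ, F) 𝓘(ℝ, E) ∞ (fun y => φ x + R (ψ y - ψ (f x))) (f x) := by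
    have h1 := contMDiffAt_of_mem_maximalAtlas hψ (hmap x hx)
    have h2 : ContDiff ℝ ∞ (fun w => φ x + R (w - ψ (f x))) := by fun_prop
    exact h2.contMDiff.contMDiffAt.comp (f x) h1
  refine ⟨fun y => φ.symm (φ x + R (ψ y - ψ (f x))), ?_, ?_, ?_⟩
  · simp [φ.left_inv hx]
  · exact (contMDiffAt_symm_of_mem_maximalAtlas hφ (φ.map_source hx)).comp_of_eq hcd hval
  · have h1 : ∀ᶠ y in 𝓝 (f x), φ x + R (ψ y - ψ (f x)) ∈ φ.target := by
      apply hcd.continuousAt.eventually_mem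
      simp only [sub_self, map_zero, add_zero]
      exact φ.open_target.mem_nhds (φ.map_source hx)
    filter_upwards [h1, ψ.open_source.mem_nhds (hmap x hx)] with y hy hy'
    apply ψ.injOn (hmap _ (φ.map_target hy)) hy'
    rw [hL _ (φ.map_target hy), φ.right_inv hy, map_add, hR, ← hL x hx]
    abel

/-- The fibre of a submersion through `x` is locally parametrized by a ball in a vector space. The
differentials at the centre of the ball exhaust the kernel of the differential of the
submersion. -/
theorem exists_fibre_parametrization {f : M → N} {x : M}
    (hf : Manifold.IsSubmersionAt 𝓘(ℝ, E) 𝓘(ℝ, F) ∞ f x) :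
    ∃ (K : Submodule ℝ E) (p : K → M) (r : ℝ), 0 < r ∧ p 0 = x ∧
      (∀ z ∈ Metric.ball 0 r, ContMDiffAt 𝓘(ℝ, K) 𝓘(ℝ, E) ∞ p z) ∧
      (∀ z ∈ Metric.ball 0 r, f (p z) = f x) ∧
      (∀ δ > 0, ∀ᶠ y in 𝓝 x, f y = f x → ∃ z ∈ Metric.ball 0 δ, p z = y) ∧
      ∀ X : E, modelDeriv E F f x X = 0 → ∃ z, modelDeriv K E p 0 z = X := by
  obtain ⟨φ, ψ, L, R, hφ, hψ, hx, hmap, hL, hR⟩ := exists_chart_of_isSubmersionAt hf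
  obtain ⟨r, hr, hball⟩ := Metric.isOpen_iff.1 φ.open_target (φ x) (φ.map_source hx)
  have hmem : ∀ z ∈ Metric.ball (0 : L.ker) r, φ x + z ∈ φ.target := by
    intro z hz
    apply hball
    simpa using hz
  have hlin : ∀ z : L.ker, ContMDiffAt 𝓘(ℝ, L.ker) 𝓘(ℝ, E) ∞ (fun z : L.ker => φ x + (z : E)) z := by
    intro z
    have : ContDiff ℝ ∞ (fun z : L.ker => φ x + (z : E)) :=
      contDiff_const.add L.ker.subtypeL.contDiff
    exact this.contMDiff.contMDiffAt
  refine ⟨L.ker, fun z => φ.symm (φ x + z), r, hr, by simp [φ.left_inv hx], ?_, ?_, ?_, ?_⟩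
  · intro z hz
    exact (contMDiffAt_symm_of_mem_maximalAtlas hφ (hmem z hz)).comp z (hlin z)
  · intro z hz
    have h1 := φ.map_target (hmem z hz)
    apply ψ.injOn (hmap _ h1) (hmap x hx)
    have hz0 : L (z : E) = 0 := z.2
    rw [hL _ h1, hL x hx, φ.right_inv (hmem z hz), map_add, hz0, add_zero]
  · intro δ hδ
    have h1 : ∀ᶠ y in 𝓝 x, φ y ∈ Metric.ball (φ x) δ :=
      (φ.continuousAt hx).eventually_mem (Metric.ball_mem_nhds _ hδ)
    filter_upwards [h1, φ.open_source.mem_nhds hx] with y hy hys hfy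
    have hz : L (φ y - φ x) = 0 := by
      rw [map_sub, ← hL y hys, ← hL x hx, hfy, sub_self]
    refine ⟨⟨φ y - φ x, hz⟩, ?_, by simp [φ.left_inv hys]⟩
    rw [mem_ball_zero_iff]
    simpa [dist_eq_norm] using hy
  · intro X hX
    have hφd : MDifferentiableAt 𝓘(ℝ, E) 𝓘(ℝ, E) φ x :=
      (contMDiffAt_of_mem_maximalAtlas hφ hx).mdifferentiableAt (by simp)
    have hφs : MDifferentiableAt 𝓘(ℝ, E) 𝓘(ℝ, E) φ.symm (φ x) :=
      (contMDiffAt_symm_of_mem_maximalAtlas hφ (φ.map_source hx)).mdifferentiableAt (by simp)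
    have hψd : MDifferentiableAt 𝓘(ℝ, F) 𝓘(ℝ, F) ψ (f x) :=
      (contMDiffAt_of_mem_maximalAtlas hψ (hmap x hx)).mdifferentiableAt (by simp)
    have hfd : MDifferentiableAt 𝓘(ℝ, E) 𝓘(ℝ, F) f x := hf.contMDiffAt.mdifferentiableAt (by simp)
    have hz : L (modelDeriv E E φ x X) = 0 := by
      have h1 : (fun y => ψ (f y)) =ᶠ[𝓝 x] fun y => L (φ y) := by
        filter_upwards [φ.open_source.mem_nhds hx] with y hy using hL y hy
      have h2 := modelDeriv_congr (E := E) (F := F) h1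
      rw [modelDeriv_comp hψd hfd rfl, modelDeriv_comp (g := L)
        L.differentiableAt.mdifferentiableAt hφd rfl, modelDeriv_eq_fderiv,
        ContinuousLinearMap.fderiv] at h2
      have h3 := DFunLike.congr_fun h2 X
      simpa [hX] using h3.symm
    refine ⟨⟨_, hz⟩, ?_⟩
    have hlin' : modelDeriv L.ker E (fun z : L.ker => φ x + (z : E)) 0 = L.ker.subtypeL := by
      rw [modelDeriv_eq_fderiv]
      exact (L.ker.subtypeL.hasFDerivAt.const_add (φ x)).fderiv
    rw [modelDeriv_comp_apply hφs ((hlin 0).mdifferentiableAt (by simp)) (by simp), hlin']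
    have h4 := modelDeriv_comp_apply hφs hφd rfl X
    have h5 : (fun y => φ.symm (φ y)) =ᶠ[𝓝 x] fun y => y := by
      filter_upwards [φ.open_source.mem_nhds hx] with y hy using φ.left_inv hy
    rw [modelDeriv_congr h5, modelDeriv_id] at h4
    exact h4.symm

variable {F' : Type*} [NormedAddCommGroup F'] [NormedSpace ℝ F']
  {P : Type*} [TopologicalSpace P] [ChartedSpace F' P]

/-- A map is smooth at `f x` if its composition with the submersion `f` is smooth at `x`. -/
theorem contMDiffAt_of_comp_submersion {f : M → N} {x : M}
    (hf : Manifold.IsSubmersionAt 𝓘(ℝ, E) 𝓘(ℝ, F) ∞ f x) {h : N → P}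
    (hh : ContMDiffAt 𝓘(ℝ, E) 𝓘(ℝ, F') ∞ (fun y => h (f y)) x) :
    ContMDiffAt 𝓘(ℝ, F) 𝓘(ℝ, F') ∞ h (f x) := by
  obtain ⟨σ, hσx, hσ, hfσ⟩ := exists_localSection hf
  refine (ContMDiffAt.comp_of_eq hh hσ hσx).congr_of_eventuallyEq ?_
  filter_upwards [hfσ] with y hy
  simp [hy]

theorem modelDeriv_surjective_of_submersion {f : M → N} {x : M}
    (hf : Manifold.IsSubmersionAt 𝓘(ℝ, E) 𝓘(ℝ, F) ∞ f x) :
    Function.Surjective (modelDeriv E F f x) := by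
  obtain ⟨σ, hσx, hσ, hfσ⟩ := exists_localSection hf
  intro w
  refine ⟨modelDeriv F E σ (f x) w, ?_⟩
  rw [← modelDeriv_comp_apply (hf.contMDiffAt.mdifferentiableAt (by simp))
    (hσ.mdifferentiableAt (by simp)) hσx, modelDeriv_congr hfσ, modelDeriv_id]
  rfl

end Submersion

/-! ### The Lie algebra of a closed connected subgroup -/

section ConnectedSubgroup

open Filter Topology

variable {E : Type*} [NormedAddCommGroup E] [NormedSpace ℝ E]
  {G : Type*} [TopologicalSpace G] [ChartedSpace E G] [Group G] {H : Subgroup G}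
  {F : Type*} [NormedAddCommGroup F] [NormedSpace ℝ F] [ChartedSpace F (G ⧸ H)]
  {F' : Type*} [NormedAddCommGroup F'] [NormedSpace ℝ F']
  {P : Type*} [TopologicalSpace P] [ChartedSpace F' P]

/-- The velocity at time `0` of a curve that lies in `H` only near time `0`. -/
theorem mem_subgroupLieAlgebra_of_eventually {c : ℝ → G} (h0 : c 0 = 1)
    (hH : ∀ᶠ t in 𝓝 0, c t ∈ H) (hc : ContMDiffAt 𝓘(ℝ, ℝ) 𝓘(ℝ, E) ∞ c 0) :
    modelDeriv ℝ E c 0 1 ∈ subgroupLieAlgebra E H := by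
  classical
  have heq : (fun t => if c t ∈ H then c t else 1) =ᶠ[𝓝 0] c := by
    filter_upwards [hH] with t ht
    simp [ht]
  refine ⟨fun t => if c t ∈ H then c t else 1, by simp [h0], fun t => ?_,
    hc.congr_of_eventuallyEq heq, ?_⟩
  · by_cases h : c t ∈ H <;> simp [h, H.one_mem]
  · exact DFunLike.congr_fun (modelDeriv_congr (E := ℝ) (F := E) heq) (1 : ℝ)

theorem coe_eq_one_iff_mem {G : Type*} [Group G] {H : Subgroup G} (g : G) :
    (g : G ⧸ H) = ((1 : G) : G ⧸ H) ↔ g ∈ H := by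
  rw [eq_comm, QuotientGroup.eq]; simp

/-- The Lie algebra of `H` is the kernel of the differential of the projection on `G ⧸ H`. -/
theorem mem_subgroupLieAlgebra_iff
    (hproj : Manifold.IsSubmersionAt 𝓘(ℝ, E) 𝓘(ℝ, F) ∞ (fun g : G => (g : G ⧸ H)) 1) (X : E) :
    X ∈ subgroupLieAlgebra E H ↔ modelDeriv E F (fun g : G => (g : G ⧸ H)) 1 X = 0 := by
  have hπ := hproj.contMDiffAt.mdifferentiableAt (by simp)
  constructor
  · rintro ⟨c, hc0, hcH, hc, rfl⟩
    have h1 := modelDeriv_comp_apply hπ (hc.mdifferentiableAt (by simp)) hc0 (1 : ℝ)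
    have h2 : (fun t => (c t : G ⧸ H)) = fun _ => ((1 : G) : G ⧸ H) := by
      ext t; exact (coe_eq_one_iff_mem _).2 (hcH t)
    rw [h2, modelDeriv_const] at h1
    exact h1.symm
  · intro hX
    obtain ⟨K, p, r, hr, hp1, hps, hpf, -, hpd⟩ := exists_fibre_parametrization hproj
    obtain ⟨z, hz⟩ := hpd X hX
    have h0 : (0 : K) ∈ Metric.ball (0 : K) r := Metric.mem_ball_self hr
    have hl : ContDiff ℝ ∞ (fun t : ℝ => t • z) := contDiff_id.smul contDiff_const
    have h1 := mem_subgroupLieAlgebra_of_eventually (E := E) (H := H) (c := fun t : ℝ => p (t • z))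
      (by simp [hp1]) ?_ ((hps 0 h0).comp_of_eq hl.contMDiff.contMDiffAt (by simp))
    · rw [modelDeriv_comp_apply ((hps 0 h0).mdifferentiableAt (by simp))
        (hl.contMDiff.contMDiffAt.mdifferentiableAt (by simp)) (by simp), modelDeriv_eq_fderiv] at h1
      have h2 : fderiv ℝ (fun t : ℝ => t • z) 0 1 = z := by
        have := ((hasDerivAt_id (0 : ℝ)).smul_const z).hasFDerivAt.fderiv
        simp only [id] at this
        rw [this]; simp
      rwa [h2, hz] at h1
    · have h3 : ∀ᶠ t : ℝ in 𝓝 0, t • z ∈ Metric.ball (0 : K) r := by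
        apply hl.continuous.continuousAt.eventually_mem
        simpa using Metric.ball_mem_nhds (0 : K) hr
      filter_upwards [h3] with t ht
      exact (coe_eq_one_iff_mem _).1 (hpf _ ht)

variable [LieGroup 𝓘(ℝ, E) ∞ G]

/-- A map on `G` whose derivative vanishes in the directions tangent to the connected subgroup `H`,
at the points of `H`, is constant on `H`. -/
theorem eq_of_modelDeriv_eq_zero_on_subgroup [IsManifold 𝓘(ℝ, F') ∞ P]
    (hproj : Manifold.IsSubmersionAt 𝓘(ℝ, E) 𝓘(ℝ, F) ∞ (fun g : G => (g : G ⧸ H)) 1)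
    (hconn : IsConnected (H : Set G)) {Φ : G → P}
    (hd : ∀ h ∈ H, MDifferentiableAt 𝓘(ℝ, E) 𝓘(ℝ, F') (fun x => Φ (x * h)) 1)
    (hz : ∀ h ∈ H, ∀ X : E, X ∈ subgroupLieAlgebra E H →
      modelDeriv E F' (fun x => Φ (x * h)) 1 X = 0) :
    ∀ h ∈ H, Φ h = Φ 1 := by
  obtain ⟨K, p, r, hr, hp1, hps, hpf, hpn, -⟩ := exists_fibre_parametrization hproj
  have hpH : ∀ z ∈ Metric.ball (0 : K) r, p z ∈ H := fun z hz => (coe_eq_one_iff_mem _).1 (hpf z hz)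
  -- The curve `t ↦ p (z + t • w) * (p z)⁻¹` lies in `H`, so that the hypothesis at `p z * h` makes
  -- the derivative of `w ↦ Φ (p w * h)` vanish on the whole ball, not only at its centre.
  have hzero : ∀ h ∈ H, ∀ z ∈ Metric.ball (0 : K) r,
      MDifferentiableAt 𝓘(ℝ, K) 𝓘(ℝ, F') (fun w => Φ (p w * h)) z ∧
      modelDeriv K F' (fun w => Φ (p w * h)) z = 0 := by
    intro h hh z hzr
    have hpz : ContMDiffAt 𝓘(ℝ, K) 𝓘(ℝ, E) ∞ (fun w => p w * (p z)⁻¹) z :=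
      (hps z hzr).mul contMDiffAt_const
    have hh' : p z * h ∈ H := H.mul_mem (hpH z hzr) hh
    have heq : (fun w => Φ (p w * h)) = fun w => (fun x => Φ (x * (p z * h))) (p w * (p z)⁻¹) := by
      ext w; simp [mul_assoc]
    have hpzd := hpz.mdifferentiableAt (n := ∞) (by simp)
    have hval : p z * (p z)⁻¹ = 1 := mul_inv_cancel _
    rw [heq]
    refine ⟨mdifferentiableAt_comp (g := fun x => Φ (x * (p z * h)))
      (f := fun w => p w * (p z)⁻¹) (hd _ hh') hpzd hval, ?_⟩
    ext w
    rw [modelDeriv_comp_apply (g := fun x => Φ (x * (p z * h)))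
      (f := fun w => p w * (p z)⁻¹) (hd _ hh') hpzd hval]
    apply hz _ hh'
    have hl : ContDiff ℝ ∞ (fun t : ℝ => z + t • w) :=
      contDiff_const.add (contDiff_id.smul contDiff_const)
    have h1 := mem_subgroupLieAlgebra_of_eventually (E := E) (H := H)
      (c := fun t : ℝ => p (z + t • w) * (p z)⁻¹) (by simp) ?_
      (hpz.comp_of_eq hl.contMDiff.contMDiffAt (by simp))
    · rw [modelDeriv_comp_apply hpzd (hl.contMDiff.contMDiffAt.mdifferentiableAt (by simp))
        (by simp), modelDeriv_eq_fderiv] at h1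
      have h2 : fderiv ℝ (fun t : ℝ => z + t • w) 0 1 = w := by
        have := (((hasDerivAt_id (0 : ℝ)).smul_const w).const_add z).hasFDerivAt.fderiv
        simp only [id] at this
        rw [this]; simp
      rwa [h2] at h1
    · have h3 : ∀ᶠ t : ℝ in 𝓝 0, z + t • w ∈ Metric.ball (0 : K) r := by
        apply hl.continuous.continuousAt.eventually_mem
        simpa using Metric.isOpen_ball.mem_nhds hzr
      filter_upwards [h3] with t ht
      exact H.mul_mem (hpH _ ht) (H.inv_mem (hpH z hzr))
  -- `Φ` is constant on `H` near each point `h` of `H`: read in a chart, `Φ (p w * h)` is a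
  -- function of `w` on a ball with vanishing derivative.
  have hloc : ∀ h ∈ H, ∀ᶠ y in 𝓝 h, y ∈ H → Φ y = Φ h := by
    intro h hh
    have h0 : (0 : K) ∈ Metric.ball (0 : K) r := Metric.mem_ball_self hr
    have hsrc : ∀ᶠ w in 𝓝 (0 : K), Φ (p w * h) ∈ (extChartAt 𝓘(ℝ, F') (Φ h)).source := by
      apply (hzero h hh 0 h0).1.continuousAt.eventually_mem
      rw [hp1, one_mul]
      exact extChartAt_source_mem_nhds (I := 𝓘(ℝ, F')) (Φ h)
    obtain ⟨δ, hδ, hδs⟩ := Metric.eventually_nhds_iff_ball.1 hsrc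
    have hmin : 0 < min δ r := lt_min hδ hr
    have hu : ∀ w ∈ Metric.ball (0 : K) (min δ r),
        HasFDerivAt (fun w => extChartAt 𝓘(ℝ, F') (Φ h) (Φ (p w * h))) (0 : K →L[ℝ] F') w := by
      intro w hw
      have hwr := Metric.ball_subset_ball (min_le_right δ r) hw
      have hχ := mdifferentiableAt_extChartAt (I := 𝓘(ℝ, F')) (x := Φ h) (y := Φ (p w * h))
        (by simpa using hδs w (Metric.ball_subset_ball (min_le_left δ r) hw))
      have h1 := mdifferentiableAt_comp hχ (hzero h hh w hwr).1 rfl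
      have h2 := modelDeriv_comp hχ (hzero h hh w hwr).1 rfl
      rw [(hzero h hh w hwr).2, ContinuousLinearMap.comp_zero, modelDeriv_eq_fderiv] at h2
      rw [← h2]
      exact h1.differentiableAt.hasFDerivAt
    have hΦ : ∀ w ∈ Metric.ball (0 : K) (min δ r), Φ (p w * h) = Φ h := by
      intro w hw
      have h1 := Metric.isOpen_ball.is_const_of_fderiv_eq_zero (𝕜 := ℝ)
        (convex_ball (0 : K) (min δ r)).isPreconnected
        (fun w hw => (hu w hw).differentiableAt.differentiableWithinAt)
        (fun w hw => (hu w hw).fderiv) hw (Metric.mem_ball_self hmin)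
      simp only [hp1, one_mul] at h1
      exact (extChartAt 𝓘(ℝ, F') (Φ h)).injOn
        (hδs w (Metric.ball_subset_ball (min_le_left δ r) hw)) (mem_extChartAt_source _) h1
    have htr : Tendsto (fun y => y * h⁻¹) (𝓝 h) (𝓝 1) := by
      have := (mdifferentiableAt_mul_right (E := E) h⁻¹ h).continuousAt.tendsto
      rwa [mul_inv_cancel] at this
    filter_upwards [htr.eventually (hpn _ hmin)] with y hy hyH
    obtain ⟨w, hw, hwy⟩ := hy ((coe_eq_one_iff_mem _).2 (H.mul_mem hyH (H.inv_mem hh)))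
    have := hΦ w hw
    rwa [hwy, inv_mul_cancel_right] at this
  have hlc : IsLocallyConstant (fun h : H => Φ h) := by
    rw [IsLocallyConstant.iff_eventually_eq]
    intro h
    have := continuous_subtype_val.continuousAt.eventually (hloc h h.2)
    filter_upwards [this] with y hy using hy y.2
  have : PreconnectedSpace H := isPreconnected_iff_preconnectedSpace.1 hconn.isPreconnected
  intro h hh
  exact hlc.apply_eq_of_preconnectedSpace ⟨h, hh⟩ ⟨1, H.one_mem⟩

end ConnectedSubgroup

/-! ### Invariance under a connected subgroup and its infinitesimal form -/

section Invariance

open Filter Topology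

variable {E : Type*} [NormedAddCommGroup E] [NormedSpace ℝ E]
  {G : Type*} [TopologicalSpace G] [ChartedSpace E G] [Group G] [LieGroup 𝓘(ℝ, E) ∞ G]
  {H : Subgroup G}
  {F : Type*} [NormedAddCommGroup F] [NormedSpace ℝ F] [ChartedSpace F (G ⧸ H)]
  {F' : Type*} [NormedAddCommGroup F'] [NormedSpace ℝ F']
  {M : Type*} [TopologicalSpace M] [ChartedSpace F' M]

/-- At a point where both factors equal `1`, the derivative of a product is the sum of the
derivatives. -/
theorem modelDeriv_mul {f g : M → G} {x : M} (hf : MDifferentiableAt 𝓘(ℝ, F') 𝓘(ℝ, E) f x)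
    (hg : MDifferentiableAt 𝓘(ℝ, F') 𝓘(ℝ, E) g x) (hf1 : f x = 1) (hg1 : g x = 1) (v : F') :
    MDifferentiableAt 𝓘(ℝ, F') 𝓘(ℝ, E) (fun y => f y * g y) x ∧
    modelDeriv F' E (fun y => f y * g y) x v = modelDeriv F' E f x v + modelDeriv F' E g x v := by
  have hm : MDifferentiableAt (𝓘(ℝ, E).prod 𝓘(ℝ, E)) 𝓘(ℝ, E) (fun p : G × G => p.1 * p.2)
      (f x, g x) :=
    (contMDiff_mul 𝓘(ℝ, E) ∞).contMDiffAt.mdifferentiableAt (by simp)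
  refine ⟨MDifferentiableAt.comp x hm (hf.prodMk hg), ?_⟩
  have h1 := mfderiv_comp x hm (hf.prodMk hg)
  have h2 : mfderiv 𝓘(ℝ, F') 𝓘(ℝ, E) (fun y => f y * g y) x v =
      mfderiv (𝓘(ℝ, E).prod 𝓘(ℝ, E)) 𝓘(ℝ, E) (fun p : G × G => p.1 * p.2) (f x, g x)
        (mfderiv 𝓘(ℝ, F') (𝓘(ℝ, E).prod 𝓘(ℝ, E)) (fun y => (f y, g y)) x v) :=
    DFunLike.congr_fun h1 v
  rw [mfderiv_prod_eq_add_apply hm, hf.mfderiv_prod hg] at h2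
  refine Eq.trans h2 ?_
  have e1 : modelDeriv E E (fun z : G => z * g x) (f x) = ContinuousLinearMap.id ℝ E := by
    simp only [hg1, mul_one, modelDeriv_id]
  have e2 : modelDeriv E E (fun z : G => f x * z) (g x) = ContinuousLinearMap.id ℝ E := by
    simp only [hf1, one_mul, modelDeriv_id]
  exact congrArg₂ (fun a b : E => a + b) (DFunLike.congr_fun e1 (modelDeriv F' E f x v))
    (DFunLike.congr_fun e2 (modelDeriv F' E g x v))

/-- An endomorphism of `G` whose differential is the identity on the Lie algebra of the connected
subgroup `H` fixes `H` pointwise. -/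
theorem apply_eq_self_of_modelDeriv_eq
    (hproj : Manifold.IsSubmersionAt 𝓘(ℝ, E) 𝓘(ℝ, F) ∞ (fun g : G => (g : G ⧸ H)) 1)
    (hconn : IsConnected (H : Set G)) {s : G ≃* G} (hs : ContMDiff 𝓘(ℝ, E) 𝓘(ℝ, E) ∞ s)
    (hd : ∀ X : E, X ∈ subgroupLieAlgebra E H → modelDeriv E E s (1 : G) X = X) :
    ∀ h ∈ H, s h = h := by
  -- The map `x ↦ x⁻¹ * s x` has vanishing derivative along `H`; it equals `1` at `1`.
  have hΦ : MDifferentiableAt 𝓘(ℝ, E) 𝓘(ℝ, E) (fun x : G => x⁻¹ * s x) 1 :=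
    (((contMDiff_inv 𝓘(ℝ, E) ∞).mul hs).contMDiffAt).mdifferentiableAt (by simp)
  have hΦz : ∀ X : E, X ∈ subgroupLieAlgebra E H →
      modelDeriv E E (fun x : G => x⁻¹ * s x) 1 X = 0 := by
    intro X hX
    have h1 := (modelDeriv_mul (f := fun x : G => x) mdifferentiableAt_id hΦ rfl (by simp) X).2
    simp only [mul_inv_cancel_left, modelDeriv_id] at h1
    have h2 := (hd X hX).symm.trans h1
    exact left_eq_add.1 h2
  have hlr : ∀ h : G, MDifferentiableAt 𝓘(ℝ, E) 𝓘(ℝ, E) (fun x : G => h⁻¹ * x * s h) 1 := fun h =>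
    ((contMDiff_const.mul contMDiff_id).mul contMDiff_const).contMDiffAt.mdifferentiableAt
      (n := ∞) (by simp)
  have heq : ∀ h : G, (fun x => (x * h)⁻¹ * s (x * h)) =
      fun x => (fun y => h⁻¹ * y * s h) (x⁻¹ * s x) := by
    intro h; ext x; simp [mul_assoc]
  have hconst := eq_of_modelDeriv_eq_zero_on_subgroup (Φ := fun x : G => x⁻¹ * s x) hproj hconn
    (fun h _ => by
      rw [heq]
      exact mdifferentiableAt_comp (hlr h) hΦ (by simp))
    (fun h _ X hX => by
      rw [heq, modelDeriv_comp_apply (g := fun y => h⁻¹ * y * s h) (hlr h) hΦ (by simp),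
        hΦz X hX, map_zero])
  intro h hh
  have h1 := hconst h hh
  simp only [map_one, inv_one, mul_one] at h1
  exact (inv_mul_eq_one.1 h1).symm

theorem adjointOrbit_mul (X : E) (g h : G) :
    adjointOrbit E X (g * h) = adjointOrbit E (adjointOrbit E X h) g := by
  have h1 : (fun x : G => g * h * x * (g * h)⁻¹) = fun x => g * (h * x * h⁻¹) * g⁻¹ := by
    ext x; simp [mul_assoc]
  simp only [adjointOrbit, h1]
  exact modelDeriv_comp_apply (g := fun x => g * x * g⁻¹) (mdifferentiableAt_conj g 1)
    (mdifferentiableAt_conj h 1) (by simp) X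

variable [CompleteSpace E]

/-- The infinitesimal form of the invariance of `b` under the adjoint representation. -/
theorem modelDeriv_adjointOrbit_bilin (b : E →L[ℝ] E →L[ℝ] ℝ) (X Y : E) :
    MDifferentiableAt 𝓘(ℝ, E) 𝓘(ℝ, ℝ)
      (fun g : G => b (adjointOrbit E X g) (adjointOrbit E Y g)) 1 ∧
    ∀ Z : E, modelDeriv E ℝ (fun g : G => b (adjointOrbit E X g) (adjointOrbit E Y g)) 1 Z =
        b (modelBracket E G Z X) Y + b X (modelBracket E G Z Y) := by
  obtain ⟨hX, hX'⟩ := modelDeriv_adjointOrbit (G := G) X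
  obtain ⟨hY, hY'⟩ := modelDeriv_adjointOrbit (G := G) Y
  have hpair : MDifferentiableAt 𝓘(ℝ, E) 𝓘(ℝ, E × E)
      (fun g : G => (adjointOrbit E X g, adjointOrbit E Y g)) 1 := hX.prodMk_space hY
  have hb : HasFDerivAt (fun q : E × E => b q.1 q.2) _
      (adjointOrbit E X (1 : G), adjointOrbit E Y (1 : G)) :=
    (b.hasFDerivAt.comp _ hasFDerivAt_fst).clm_apply hasFDerivAt_snd
  have hbm := hb.differentiableAt.mdifferentiableAt
  refine ⟨mdifferentiableAt_comp (g := fun q : E × E => b q.1 q.2) hbm hpair rfl, fun Z => ?_⟩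
  have h1 := modelDeriv_comp_apply (g := fun q : E × E => b q.1 q.2) hbm hpair rfl Z
  have h2 : modelDeriv E (E × E) (fun g : G => (adjointOrbit E X g, adjointOrbit E Y g)) 1 Z =
      (modelBracket E G Z X, modelBracket E G Z Y) := by
    rw [← hX', ← hY']
    have h3 := modelDeriv_comp_apply (g := Prod.fst)
      (differentiableAt_fst (𝕜 := ℝ) (E := E) (F := E)).mdifferentiableAt hpair rfl Z
    have h4 := modelDeriv_comp_apply (g := Prod.snd)
      (differentiableAt_snd (𝕜 := ℝ) (E := E) (F := E)).mdifferentiableAt hpair rfl Z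
    rw [modelDeriv_eq_fderiv, fderiv_fst] at h3
    rw [modelDeriv_eq_fderiv, fderiv_snd] at h4
    exact Prod.ext h3.symm h4.symm
  refine h1.trans ?_
  rw [h2, modelDeriv_eq_fderiv, hb.fderiv, adjointOrbit_one, adjointOrbit_one]
  simp [add_comm]

/-- For a connected subgroup `H`, infinitesimal invariance of a bilinear form under the Lie algebra
of `H` integrates to invariance under `Ad H`. -/
theorem bilin_adjointOrbit_eq
    (hproj : Manifold.IsSubmersionAt 𝓘(ℝ, E) 𝓘(ℝ, F) ∞ (fun g : G => (g : G ⧸ H)) 1)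
    (hconn : IsConnected (H : Set G)) {b : E →L[ℝ] E →L[ℝ] ℝ}
    (hb : ∀ Z : E, Z ∈ subgroupLieAlgebra E H → ∀ X Y,
      b (modelBracket E G Z X) Y + b X (modelBracket E G Z Y) = 0) {h : G} (hh : h ∈ H) (X Y : E) :
    b (adjointOrbit E X h) (adjointOrbit E Y h) = b X Y := by
  have h1 := eq_of_modelDeriv_eq_zero_on_subgroup (P := ℝ) hproj hconn
    (Φ := fun g => b (adjointOrbit E X g) (adjointOrbit E Y g))
    (fun h _ => by
      simp only [adjointOrbit_mul]
      exact (modelDeriv_adjointOrbit_bilin b _ _).1)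
    (fun h _ Z hZ => by
      simp only [adjointOrbit_mul]
      rw [(modelDeriv_adjointOrbit_bilin b _ _).2, hb Z hZ]) h hh
  simpa only [adjointOrbit_one] using h1

/-- A bilinear form that is invariant under `Ad H` is infinitesimally invariant. -/
theorem bilin_modelBracket_eq_zero {b : E →L[ℝ] E →L[ℝ] ℝ}
    (hb : ∀ h ∈ H, ∀ X Y : E, b (adjointOrbit E X h) (adjointOrbit E Y h) = b X Y)
    {Z : E} (hZ : Z ∈ subgroupLieAlgebra E H) (X Y : E) :
    b (modelBracket E G Z X) Y + b X (modelBracket E G Z Y) = 0 := by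
  obtain ⟨c, hc0, hcH, hc, rfl⟩ := hZ
  obtain ⟨hd, hd'⟩ := modelDeriv_adjointOrbit_bilin (G := G) b X Y
  have h1 := modelDeriv_comp_apply hd (hc.mdifferentiableAt (by simp)) hc0 (1 : ℝ)
  simp only [fun t => hb _ (hcH t) X Y, modelDeriv_const] at h1
  exact (hd' _).symm.trans h1.symm

end Invariance

/-! ### Scalar products on finite dimensional spaces -/

section PositiveForms

open Filter Topology

variable {F : Type*} [NormedAddCommGroup F] [NormedSpace ℝ F]

/-- The unit ball of a positive definite form on a finite dimensional space is bounded. -/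
theorem isVonNBounded_of_pos [FiniteDimensional ℝ F] (c : F →L[ℝ] F →L[ℝ] ℝ)
    (hpos : ∀ v, v ≠ 0 → 0 < c v v) : Bornology.IsVonNBounded ℝ {v : F | c v v < 1} := by
  rw [NormedSpace.isVonNBounded_iff, Metric.isBounded_iff_subset_closedBall 0]
  have hcont : Continuous fun v : F => c v v := by fun_prop
  rcases (Metric.sphere (0 : F) 1).eq_empty_or_nonempty with he | hne
  · refine ⟨0, fun v _ => ?_⟩
    by_contra hv
    have hv0 : v ≠ 0 := by rintro rfl; simp at hv
    have : (‖v‖⁻¹ • v) ∈ Metric.sphere (0 : F) 1 := by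
      simp [norm_smul, hv0]
    rw [he] at this
    exact this
  -- By compactness the form has a positive minimum `c w w` on the unit sphere.
  · obtain ⟨w, hw, hmin⟩ := (isCompact_sphere (0 : F) 1).exists_isMinOn hne hcont.continuousOn
    have hw0 : w ≠ 0 := by rintro rfl; simp at hw
    have hm := hpos w hw0
    refine ⟨1 / c w w + 1, fun v hv => ?_⟩
    rcases eq_or_ne v 0 with rfl | hv0
    · simp; positivity
    have hn : 0 < ‖v‖ := norm_pos_iff.2 hv0
    have h1 : c w w ≤ c (‖v‖⁻¹ • v) (‖v‖⁻¹ • v) := hmin (by simp [norm_smul, hv0])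
    have h2 : c w w * ‖v‖ ^ 2 ≤ c v v := by
      simp only [map_smul, smul_apply, smul_eq_mul] at h1
      calc c w w * ‖v‖ ^ 2 ≤ (‖v‖⁻¹ * (‖v‖⁻¹ * c v v)) * ‖v‖ ^ 2 := by gcongr
        _ = c v v := by field_simp
    have h3 : c w w * ‖v‖ ^ 2 < 1 := h2.trans_lt hv
    rw [mem_closedBall_zero_iff]
    by_contra hlt
    push Not at hlt
    have h4 : 1 < c w w * ‖v‖ := by
      have : c w w * (1 / c w w + 1) < c w w * ‖v‖ := by gcongr
      rw [mul_add, mul_one_div_cancel hm.ne'] at this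
      linarith
    have h5 : 1 < ‖v‖ := by
      have : 0 < 1 / c w w := by positivity
      linarith
    nlinarith

end PositiveForms

/-! ### The action on the homogeneous space -/

section Action

open Filter Topology

variable {E : Type*} [NormedAddCommGroup E] [NormedSpace ℝ E]
  {G : Type*} [TopologicalSpace G] [ChartedSpace E G] [Group G] [LieGroup 𝓘(ℝ, E) ∞ G]
  {H : Subgroup G}
  {F : Type*} [NormedAddCommGroup F] [NormedSpace ℝ F] [ChartedSpace F (G ⧸ H)]

/-- The action of `G` on `G ⧸ H` is smooth: locally `a • y = π (a * σ y)` for a section `σ` of the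
projection. -/
theorem contMDiff_smul_quotient
    (hproj : Manifold.IsSubmersion 𝓘(ℝ, E) 𝓘(ℝ, F) ∞ (fun g : G => (g : G ⧸ H))) :
    ContMDiff (𝓘(ℝ, E).prod 𝓘(ℝ, F)) 𝓘(ℝ, F) ∞ (fun p : G × G ⧸ H => p.1 • p.2) := by
  rintro ⟨a, y⟩
  obtain ⟨g, rfl⟩ := QuotientGroup.mk_surjective y
  obtain ⟨σ, hσg, hσ, hπσ⟩ := exists_localSection (hproj.isSubmersionAt g)
  have h1 : ContMDiffAt (𝓘(ℝ, E).prod 𝓘(ℝ, F)) 𝓘(ℝ, E) ∞ (fun p : G × G ⧸ H => p.1 * σ p.2)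
      (a, (g : G ⧸ H)) :=
    contMDiffAt_fst.mul (hσ.comp (a, (g : G ⧸ H)) contMDiffAt_snd)
  refine (hproj.contMDiff.contMDiffAt.comp _ h1).congr_of_eventuallyEq ?_
  have h2 := (continuousAt_snd (p := (a, (g : G ⧸ H)))).eventually hπσ
  filter_upwards [h2] with p hp
  conv_lhs => rw [← hp]
  rfl

theorem contMDiff_smul_right
    (hproj : Manifold.IsSubmersion 𝓘(ℝ, E) 𝓘(ℝ, F) ∞ (fun g : G => (g : G ⧸ H))) (a : G) :
    ContMDiff 𝓘(ℝ, F) 𝓘(ℝ, F) ∞ (fun y : G ⧸ H => a • y) :=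
  (contMDiff_smul_quotient hproj).comp (contMDiff_const.prodMk contMDiff_id)
    (f := fun y : G ⧸ H => (a, y))

theorem mdifferentiableAt_smul
    (hproj : Manifold.IsSubmersion 𝓘(ℝ, E) 𝓘(ℝ, F) ∞ (fun g : G => (g : G ⧸ H)))
    (a : G) (y : G ⧸ H) : MDifferentiableAt 𝓘(ℝ, F) 𝓘(ℝ, F) (fun y : G ⧸ H => a • y) y :=
  (contMDiff_smul_right hproj a).contMDiffAt.mdifferentiableAt (by simp)

variable (F) in
/-- The differential of the translation `y ↦ a • y` of `G ⧸ H`. -/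
noncomputable def smulDeriv (a : G) (y : G ⧸ H) : F →L[ℝ] F :=
  modelDeriv F F (fun z : G ⧸ H => a • z) y

theorem smulDeriv_mul
    (hproj : Manifold.IsSubmersion 𝓘(ℝ, E) 𝓘(ℝ, F) ∞ (fun g : G => (g : G ⧸ H)))
    (a b : G) {y z : G ⧸ H} (hz : b • y = z) (v : F) :
    smulDeriv F (a * b) y v = smulDeriv F a z (smulDeriv F b y v) := by
  simp only [smulDeriv, mul_smul]
  exact modelDeriv_comp_apply (g := fun y : G ⧸ H => a • y) (mdifferentiableAt_smul hproj a z)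
    (mdifferentiableAt_smul hproj b y) hz v

omit [ChartedSpace E G] [LieGroup 𝓘(ℝ, E) ∞ G] in
theorem smulDeriv_one (y : G ⧸ H) (v : F) : smulDeriv F (1 : G) y v = v := by
  simp only [smulDeriv, one_smul, modelDeriv_id]
  rfl

theorem smulDeriv_inv_cancel
    (hproj : Manifold.IsSubmersion 𝓘(ℝ, E) 𝓘(ℝ, F) ∞ (fun g : G => (g : G ⧸ H)))
    (a : G) {y z : G ⧸ H} (hz : a • y = z) (v : F) :
    smulDeriv F a⁻¹ z (smulDeriv F a y v) = v := by
  rw [← smulDeriv_mul hproj _ _ hz, inv_mul_cancel, smulDeriv_one]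

/-- The projection `G → G ⧸ H` intertwines `Ad h` with the isotropy representation of `h ∈ H`. -/
theorem modelDeriv_mk_adjointOrbit
    (hproj : Manifold.IsSubmersion 𝓘(ℝ, E) 𝓘(ℝ, F) ∞ (fun g : G => (g : G ⧸ H)))
    {h : G} (hh : h ∈ H) (X : E) :
    modelDeriv E F (fun g : G => (g : G ⧸ H)) 1 (adjointOrbit E X h) =
      smulDeriv F h ((1 : G) : G ⧸ H) (modelDeriv E F (fun g : G => (g : G ⧸ H)) 1 X) := by
  have hπ : MDifferentiableAt 𝓘(ℝ, E) 𝓘(ℝ, F) (fun g : G => (g : G ⧸ H)) 1 :=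
    hproj.contMDiff.contMDiffAt.mdifferentiableAt (by simp)
  rw [adjointOrbit, smulDeriv, ← modelDeriv_comp_apply hπ (mdifferentiableAt_conj h 1) (by simp),
    ← modelDeriv_comp_apply (mdifferentiableAt_smul hproj h _) hπ rfl]
  congr 2
  ext x
  have : ((h * x * h⁻¹ : G) : G ⧸ H) = ((h * x : G) : G ⧸ H) := by
    have hx : (h * x * h⁻¹)⁻¹ * (h * x) = h := by group
    rw [QuotientGroup.eq, hx]; exact hh
  rw [this]
  rfl

end Action

/-! ### Invariant metrics -/

section InvariantMetric

open Filter Topology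

variable {E : Type*} [NormedAddCommGroup E] [NormedSpace ℝ E]
  {G : Type*} [TopologicalSpace G] [ChartedSpace E G] [Group G] [LieGroup 𝓘(ℝ, E) ∞ G]
  {H : Subgroup G}
  {F : Type*} [NormedAddCommGroup F] [NormedSpace ℝ F] [ChartedSpace F (G ⧸ H)]

/-- The form at the point `x` of `G ⧸ H` obtained by transporting the form `b` at the base point by
the translation by the inverse of the chosen representative of the coset `x`. -/
noncomputable def transportedForm (b : F →L[ℝ] F →L[ℝ] ℝ) (x : G ⧸ H) :
    TangentSpace 𝓘(ℝ, F) x →L[ℝ] TangentSpace 𝓘(ℝ, F) x →L[ℝ] ℝ :=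
  (b.bilinearComp (smulDeriv F x.out⁻¹ x) (smulDeriv F x.out⁻¹ x) : F →L[ℝ] F →L[ℝ] ℝ)

theorem smul_eq_one_iff {G : Type*} [Group G] {H : Subgroup G} (a g : G) :
    a • (g : G ⧸ H) = ((1 : G) : G ⧸ H) ↔ a * g ∈ H :=
  coe_eq_one_iff_mem (a * g)

/-- If `b` is invariant under the isotropy representation, then every translation that moves `x` to
the base point can be used to compute the transported form. -/
theorem transportedForm_apply
    (hproj : Manifold.IsSubmersion 𝓘(ℝ, E) 𝓘(ℝ, F) ∞ (fun g : G => (g : G ⧸ H)))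
    {b : F →L[ℝ] F →L[ℝ] ℝ}
    (hb : ∀ h ∈ H, ∀ u v, b (smulDeriv F h ((1 : G) : G ⧸ H) u)
      (smulDeriv F h ((1 : G) : G ⧸ H) v) = b u v)
    {a : G} {x : G ⧸ H} (ha : a • x = ((1 : G) : G ⧸ H)) (u v : F) :
    transportedForm b x u v = b (smulDeriv F a x u) (smulDeriv F a x v) := by
  have hout : x.out⁻¹ • x = ((1 : G) : G ⧸ H) := by
    nth_rw 2 [← QuotientGroup.out_eq' x]
    rw [smul_eq_one_iff, inv_mul_cancel]
    exact H.one_mem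
  have hmem : a * x.out ∈ H := by
    rw [← smul_eq_one_iff]
    rw [QuotientGroup.out_eq', ha]
  have key : ∀ w, smulDeriv F a x w =
      smulDeriv F (a * x.out) ((1 : G) : G ⧸ H) (smulDeriv F x.out⁻¹ x w) := by
    intro w
    rw [← smulDeriv_mul hproj _ _ hout, mul_inv_cancel_right]
  rw [key, key, hb _ hmem]
  rfl

variable [IsManifold 𝓘(ℝ, F) ∞ (G ⧸ H)]

/-- The transported form is smooth: near a given point it can be computed with the translations by
the inverses of a smooth local section of the projection. -/
theorem contMDiff_transportedForm
    (hproj : Manifold.IsSubmersion 𝓘(ℝ, E) 𝓘(ℝ, F) ∞ (fun g : G => (g : G ⧸ H)))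
    {b : F →L[ℝ] F →L[ℝ] ℝ}
    (hb : ∀ h ∈ H, ∀ u v, b (smulDeriv F h ((1 : G) : G ⧸ H) u)
      (smulDeriv F h ((1 : G) : G ⧸ H) v) = b u v) :
    ContMDiff 𝓘(ℝ, F) (𝓘(ℝ, F).prod 𝓘(ℝ, F →L[ℝ] F →L[ℝ] ℝ)) ∞
      (fun x : G ⧸ H => Bundle.TotalSpace.mk' (F →L[ℝ] F →L[ℝ] ℝ)
        (E := fun x : G ⧸ H => TangentSpace 𝓘(ℝ, F) x →L[ℝ] TangentSpace 𝓘(ℝ, F) x →L[ℝ] ℝ)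
        x (transportedForm b x)) := by
  intro x₀
  obtain ⟨g, rfl⟩ := QuotientGroup.mk_surjective x₀
  obtain ⟨σ, hσg, hσ, hπσ⟩ := exists_localSection (hproj.isSubmersionAt g)
  have hone : ∀ᶠ x in 𝓝 (g : G ⧸ H), (σ x)⁻¹ • x = ((1 : G) : G ⧸ H) := by
    filter_upwards [hπσ] with x hx
    nth_rw 2 [← hx]
    rw [smul_eq_one_iff, inv_mul_cancel]
    exact H.one_mem
  have hact : ContMDiffAt (𝓘(ℝ, F).prod 𝓘(ℝ, F)) 𝓘(ℝ, F) ∞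
      (Function.uncurry fun (x y : G ⧸ H) => (σ x)⁻¹ • y) ((g : G ⧸ H), (g : G ⧸ H)) := by
    have h1 : ContMDiffAt (𝓘(ℝ, F).prod 𝓘(ℝ, F)) 𝓘(ℝ, E) ∞
        (fun p : (G ⧸ H) × (G ⧸ H) => (σ p.1)⁻¹) ((g : G ⧸ H), (g : G ⧸ H)) :=
      (hσ.comp ((g : G ⧸ H), (g : G ⧸ H)) contMDiffAt_fst).inv
    exact (contMDiff_smul_quotient hproj).contMDiffAt.comp _ (h1.prodMk contMDiffAt_snd)
  have hA := ContMDiffAt.mfderiv (I := 𝓘(ℝ, F)) (I' := 𝓘(ℝ, F)) (n := ∞) (m := ∞)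
    (x₀ := (g : G ⧸ H))
    (fun (x y : G ⧸ H) => (σ x)⁻¹ • y) id hact contMDiffAt_id (by simp)
  rw [Bundle.contMDiffAt_section]
  have hcomp : ContMDiffAt 𝓘(ℝ, F) 𝓘(ℝ, F →L[ℝ] F →L[ℝ] ℝ) ∞ (fun x =>
    b.bilinearComp (inTangentCoordinates 𝓘(ℝ, F) 𝓘(ℝ, F) id (fun x => (σ x)⁻¹ • id x)
      (fun x => mfderiv 𝓘(ℝ, F) 𝓘(ℝ, F) (fun y : G ⧸ H => (σ x)⁻¹ • y) (id x)) (g : G ⧸ H) x)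
      (inTangentCoordinates 𝓘(ℝ, F) 𝓘(ℝ, F) id (fun x => (σ x)⁻¹ • id x)
      (fun x => mfderiv 𝓘(ℝ, F) 𝓘(ℝ, F) (fun y : G ⧸ H => (σ x)⁻¹ • y) (id x)) (g : G ⧸ H) x))
      (g : G ⧸ H) := by
    have hbil : ContDiff ℝ ∞ (fun A : F →L[ℝ] F => b.bilinearComp A A) := by
      have hflip : ContDiff ℝ ∞ (fun c : F →L[ℝ] F →L[ℝ] ℝ => c.flip) := by
        exact ContinuousLinearMap.contDiff (𝕜 := ℝ) (E := F →L[ℝ] F →L[ℝ] ℝ)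
          (F := F →L[ℝ] F →L[ℝ] ℝ)
          (ContinuousLinearMap.flipₗᵢ ℝ F F ℝ).toContinuousLinearEquiv.toContinuousLinearMap
      exact hflip.comp ((hflip.comp (contDiff_const.clm_comp contDiff_id)).clm_comp contDiff_id)
    exact hbil.contMDiff.contMDiffAt.comp _ hA
  refine hcomp.congr_of_eventuallyEq ?_
  have hsrc : ∀ᶠ x in 𝓝 (g : G ⧸ H), x ∈ (chartAt F (g : G ⧸ H)).source :=
    (chartAt F (g : G ⧸ H)).open_source.mem_nhds (mem_chart_source F _)
  filter_upwards [hsrc, hone] with x hx hx1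
  have hmemF : x ∈ (trivializationAt F (TangentSpace 𝓘(ℝ, F)) (g : G ⧸ H)).baseSet := by
    simpa using hx
  have hmem2 : x ∈ (trivializationAt (F →L[ℝ] ℝ)
      (fun x : G ⧸ H => TangentSpace 𝓘(ℝ, F) x →L[ℝ] ℝ) (g : G ⧸ H)).baseSet := by
    simpa [hom_trivializationAt_baseSet] using hx
  -- The coordinates of the form with respect to the trivialization of the bundle of forms.
  have hlhs : ∀ u v : F, (trivializationAt (F →L[ℝ] F →L[ℝ] ℝ)
      (fun x : G ⧸ H => TangentSpace 𝓘(ℝ, F) x →L[ℝ] TangentSpace 𝓘(ℝ, F) x →L[ℝ] ℝ) (g : G ⧸ H)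
      ⟨x, transportedForm b x⟩).2 u v = transportedForm b x
        ((trivializationAt F (TangentSpace 𝓘(ℝ, F)) (g : G ⧸ H)).symmL ℝ x u)
        ((trivializationAt F (TangentSpace 𝓘(ℝ, F)) (g : G ⧸ H)).symmL ℝ x v) := by
    intro u v
    rw [hom_trivializationAt_apply]
    simp only [ContinuousLinearMap.inCoordinates, ContinuousLinearMap.comp_apply]
    rw [Bundle.Trivialization.continuousLinearMapAt_apply,
      Bundle.Trivialization.coe_linearMapAt_of_mem _ hmem2]
    simp [hom_trivializationAt_apply, ContinuousLinearMap.inCoordinates]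
  -- All the points `(σ x)⁻¹ • x` are the base point, where the chart has the identity as derivative.
  have key : ∀ w : F, smulDeriv F (σ x)⁻¹ x
      ((trivializationAt F (TangentSpace 𝓘(ℝ, F)) (g : G ⧸ H)).symmL ℝ x w) =
      inTangentCoordinates 𝓘(ℝ, F) 𝓘(ℝ, F) id (fun x => (σ x)⁻¹ • id x)
        (fun x => mfderiv 𝓘(ℝ, F) 𝓘(ℝ, F) (fun y : G ⧸ H => (σ x)⁻¹ • y) (id x))
        (g : G ⧸ H) x w := by
    intro w
    have h0 : (σ (g : G ⧸ H))⁻¹ • (g : G ⧸ H) = ((1 : G) : G ⧸ H) := hone.self_of_nhds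
    have h1 : (σ x)⁻¹ • x ∈ (chartAt F ((σ (g : G ⧸ H))⁻¹ • (g : G ⧸ H))).source := by
      rw [hx1, h0]
      exact mem_chart_source F _
    have h2 : modelDeriv F F (extChartAt 𝓘(ℝ, F) ((σ (g : G ⧸ H))⁻¹ • (g : G ⧸ H)))
        ((σ x)⁻¹ • x) = ContinuousLinearMap.id ℝ F := by
      rw [h0, hx1]
      exact modelDeriv_extChartAt_self _
    have h3 := inTangentCoordinates_eq_mfderiv_comp (I := 𝓘(ℝ, F)) (I' := 𝓘(ℝ, F))
      (f := id) (g := fun x => (σ x)⁻¹ • id x)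
      (ϕ := fun x => mfderiv 𝓘(ℝ, F) 𝓘(ℝ, F) (fun y : G ⧸ H => (σ x)⁻¹ • y) (id x))
      (x₀ := (g : G ⧸ H)) (x := x) hx h1
    have h4 := DFunLike.congr_fun h3 w
    refine Eq.trans ?_ h4.symm
    have h5 := TangentBundle.symmL_trivializationAt (I := 𝓘(ℝ, F)) hx
    have h6 := DFunLike.congr_fun h5 w
    refine (congrArg (smulDeriv F (σ x)⁻¹ x) h6).trans ?_
    exact (DFunLike.congr_fun h2 _).symm
  ext u v
  refine (hlhs u v).trans ((transportedForm_apply hproj hb hx1 _ _).trans ?_)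
  exact congrArg₂ (fun p q : F => b p q) (key u) (key v)

/-- The value of the metric `g` at `x`, as a form on the model space of `G ⧸ H`. -/
noncomputable def innerAt (g : Metric F H) (x : G ⧸ H) : F →L[ℝ] F →L[ℝ] ℝ := g.inner x

omit [ChartedSpace E G] [LieGroup 𝓘(ℝ, E) ∞ G] in
theorem preserves_iff {g : Metric F H} {f : G ⧸ H → G ⧸ H} :
    Preserves g f ↔ ∀ (y : G ⧸ H) (u v : F),
      innerAt g (f y) (modelDeriv F F f y u) (modelDeriv F F f y v) = innerAt g y u v :=
  Iff.rfl

omit [TopologicalSpace G] [ChartedSpace E G] [LieGroup 𝓘(ℝ, E) ∞ G] [ChartedSpace F (G ⧸ H)]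
  [IsManifold 𝓘(ℝ, F) ∞ (G ⧸ H)] in
theorem exists_smul_eq_one (x : G ⧸ H) : ∃ a : G, a • x = ((1 : G) : G ⧸ H) := by
  obtain ⟨g, rfl⟩ := QuotientGroup.mk_surjective x
  exact ⟨g⁻¹, by rw [smul_eq_one_iff, inv_mul_cancel]; exact H.one_mem⟩

/-- The invariant metric of `G ⧸ H` whose value at the base point is the form `b`, where `b` is a
scalar product that is invariant under the isotropy representation of `H`. -/
noncomputable def invariantMetric [FiniteDimensional ℝ F]
    (hproj : Manifold.IsSubmersion 𝓘(ℝ, E) 𝓘(ℝ, F) ∞ (fun g : G => (g : G ⧸ H)))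
    (b : F →L[ℝ] F →L[ℝ] ℝ) (hsymm : ∀ u v, b u v = b v u) (hpos : ∀ u, u ≠ 0 → 0 < b u u)
    (hb : ∀ h ∈ H, ∀ u v, b (smulDeriv F h ((1 : G) : G ⧸ H) u)
      (smulDeriv F h ((1 : G) : G ⧸ H) v) = b u v) : Metric F H :=
  have hpos' : ∀ (x : G ⧸ H) (v : F), v ≠ 0 →
      0 < (transportedForm b x : F →L[ℝ] F →L[ℝ] ℝ) v v := by
    intro x v hv
    obtain ⟨a, ha⟩ := exists_smul_eq_one x
    refine (hpos (smulDeriv F a x v) fun h0 => hv ?_).trans_eq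
      (transportedForm_apply hproj hb ha v v).symm
    rw [← smulDeriv_inv_cancel hproj a ha v, h0, map_zero]
  { inner := transportedForm b
    symm := fun _ _ _ => hsymm _ _
    pos := hpos'
    isVonNBounded := fun x => isVonNBounded_of_pos (F := F) (transportedForm b x) (hpos' x)
    contMDiff := contMDiff_transportedForm hproj hb }

theorem innerAt_invariantMetric [FiniteDimensional ℝ F]
    (hproj : Manifold.IsSubmersion 𝓘(ℝ, E) 𝓘(ℝ, F) ∞ (fun g : G => (g : G ⧸ H)))
    {b : F →L[ℝ] F →L[ℝ] ℝ} (hsymm : ∀ u v, b u v = b v u) (hpos : ∀ u, u ≠ 0 → 0 < b u u)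
    (hb : ∀ h ∈ H, ∀ u v, b (smulDeriv F h ((1 : G) : G ⧸ H) u)
      (smulDeriv F h ((1 : G) : G ⧸ H) v) = b u v) {a : G} {x : G ⧸ H}
    (ha : a • x = ((1 : G) : G ⧸ H)) (u v : F) :
    innerAt (invariantMetric hproj b hsymm hpos hb) x u v =
      b (smulDeriv F a x u) (smulDeriv F a x v) :=
  transportedForm_apply hproj hb ha u v

theorem isInvariant_invariantMetric [FiniteDimensional ℝ F]
    (hproj : Manifold.IsSubmersion 𝓘(ℝ, E) 𝓘(ℝ, F) ∞ (fun g : G => (g : G ⧸ H)))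
    {b : F →L[ℝ] F →L[ℝ] ℝ} (hsymm : ∀ u v, b u v = b v u) (hpos : ∀ u, u ≠ 0 → 0 < b u u)
    (hb : ∀ h ∈ H, ∀ u v, b (smulDeriv F h ((1 : G) : G ⧸ H) u)
      (smulDeriv F h ((1 : G) : G ⧸ H) v) = b u v) :
    IsInvariant (invariantMetric hproj b hsymm hpos hb) := by
  intro a
  rw [preserves_iff]
  intro y u v
  obtain ⟨c, hc⟩ := exists_smul_eq_one (a • y)
  rw [innerAt_invariantMetric hproj hsymm hpos hb hc,
    innerAt_invariantMetric hproj hsymm hpos hb (a := c * a) (by rw [mul_smul, hc]),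
    smulDeriv_mul hproj c a rfl, smulDeriv_mul hproj c a rfl]
  rfl

/-- An invariant metric is determined by its value at the base point. -/
theorem innerAt_eq_of_isInvariant {g : Metric F H} (hg : IsInvariant g) {a : G} {x : G ⧸ H}
    (ha : a • x = ((1 : G) : G ⧸ H)) (u v : F) :
    innerAt g x u v =
      innerAt g ((1 : G) : G ⧸ H) (smulDeriv F a x u) (smulDeriv F a x v) := by
  rw [← ha]
  exact (preserves_iff.1 (hg a) x u v).symm

omit [ChartedSpace E G] [LieGroup 𝓘(ℝ, E) ∞ G] in
theorem metric_ext {g g' : Metric F H} (h : ∀ x u v, innerAt g x u v = innerAt g' x u v) :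
    g = g' := by
  have h1 : g.inner = g'.inner := by
    ext x u v
    exact h x u v
  cases g
  cases g'
  cases h1
  rfl

end InvariantMetric

/-! ### The Koszul identity -/

section LinearAlgebra

variable {V : Type*} [AddCommGroup V] [Module ℝ V] [FiniteDimensional ℝ V]

/-- A Koszul type identity determines a symmetric product: the right hand side is a linear form in
`Z`, which the scalar product `B` represents by a unique vector. -/
theorem existsUnique_koszul {B : LinearMap.BilinForm ℝ V} (hsymm : ∀ X Y, B X Y = B Y X)
    (hpos : ∀ X, X ≠ 0 → 0 < B X X) (A : V →ₗ[ℝ] V →ₗ[ℝ] V) :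
    ∃! U : V →ₗ[ℝ] V →ₗ[ℝ] V, (∀ X Y, U X Y = U Y X) ∧
      ∀ X Y Z, 2 * B (U X Y) Z = B X (A Z Y) + B (A Z X) Y := by
  have hzero : ∀ X, (∀ Y, B X Y = 0) → X = 0 := by
    intro X hX
    by_contra h
    exact (hpos X h).ne' (hX X)
  have hinj : ∀ X X', (∀ Y, B X Y = B X' Y) → X = X' := by
    intro X X' h
    refine sub_eq_zero.1 (hzero _ fun Y => ?_)
    simp [h Y]
  have hbij : Function.Bijective B := by
    have hB : Function.Injective B := fun X X' h => hinj X X' fun Y => by rw [h]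
    exact ⟨hB, (LinearMap.injective_iff_surjective_of_finrank_eq_finrank
      (Subspace.dual_finrank_eq (K := ℝ) (V := V)).symm).1 hB⟩
  -- The right hand side of the identity, as a linear form in `Z`.
  let R : V →ₗ[ℝ] V →ₗ[ℝ] Module.Dual ℝ V :=
    LinearMap.mk₂ ℝ (fun X Y => (B X) ∘ₗ (A.flip Y) + (B.flip Y) ∘ₗ (A.flip X))
      (fun X X' Y => by ext Z; simp; ring) (fun c X Y => by ext Z; simp)
      (fun X Y Y' => by ext Z; simp; ring) (fun c X Y => by ext Z; simp)
  let e : V ≃ₗ[ℝ] Module.Dual ℝ V := LinearEquiv.ofBijective B hbij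
  have he : ∀ (l : Module.Dual ℝ V) Z, B (e.symm l) Z = l Z := by
    intro l Z
    exact DFunLike.congr_fun (e.apply_symm_apply l) Z
  let U : V →ₗ[ℝ] V →ₗ[ℝ] V := (2⁻¹ : ℝ) • R.compr₂ e.symm.toLinearMap
  have hU : ∀ X Y Z, 2 * B (U X Y) Z = B X (A Z Y) + B (A Z X) Y := by
    intro X Y Z
    simp [U, R, he]
    ring
  refine ⟨U, ⟨fun X Y => hinj _ _ fun Z => ?_, hU⟩, ?_⟩
  · have h1 := hU X Y Z
    have h2 := hU Y X Z
    rw [hsymm Y, hsymm (A Z Y)] at h2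
    linarith
  · rintro U' ⟨-, hU'⟩
    ext X Y
    refine hinj _ _ fun Z => ?_
    have h1 := hU X Y Z
    have h2 := hU' X Y Z
    linarith

end LinearAlgebra

/-! ### Characters of the grading group -/

section Sign

variable {k : ℕ}

theorem sign_zero (a : Fin k → ZMod 2) : sign a 0 = 1 := by simp [sign]

theorem sign_mul_self (a γ : Fin k → ZMod 2) : sign a γ * sign a γ = 1 := by
  rw [sign, ← mul_pow]
  simp

/-- The characters of `ℤ₂ᵏ` separate points. -/
theorem exists_sign_mul_ne_one {γ γ' : Fin k → ZMod 2} (h : γ ≠ γ') :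
    ∃ a, sign a γ * sign a γ' ≠ 1 := by
  obtain ⟨i, hi⟩ := Function.ne_iff.1 h
  refine ⟨Pi.single i 1, ?_⟩
  have hs : ∀ δ : Fin k → ZMod 2, ∑ j, (Pi.single i 1 : Fin k → ZMod 2) j * δ j = δ i := by
    intro δ
    simp [Pi.single_apply]
  simp only [sign, hs]
  generalize γ i = c at hi
  generalize γ' i = d at hi
  fin_cases c <;> fin_cases d <;>
    first
    | exact absurd rfl hi
    | (simp [ZMod.val]; norm_num)

end Sign

/-! ### The tangent space at the base point -/

section Isotropy

variable {E : Type*} [NormedAddCommGroup E] [NormedSpace ℝ E]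
  {G : Type*} [TopologicalSpace G] [ChartedSpace E G] [Group G]
  {H : Subgroup G}
  {F : Type*} [NormedAddCommGroup F] [NormedSpace ℝ F] [ChartedSpace F (G ⧸ H)]

/-- The differential `𝔤 → T_o (G ⧸ H)` of the projection, as a map between the model spaces. -/
noncomputable def projDeriv (E F : Type*) [NormedAddCommGroup E] [NormedSpace ℝ E]
    [NormedAddCommGroup F] [NormedSpace ℝ F] {G : Type*} [TopologicalSpace G] [ChartedSpace E G]
    [Group G] (H : Subgroup G) [ChartedSpace F (G ⧸ H)] :
    GroupLieAlgebra 𝓘(ℝ, E) G →L[ℝ] F :=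
  modelDeriv E F (fun g : G => (g : G ⧸ H)) 1

theorem projDeriv_surjective
    (hproj : Manifold.IsSubmersion 𝓘(ℝ, E) 𝓘(ℝ, F) ∞ (fun g : G => (g : G ⧸ H))) :
    Function.Surjective (projDeriv E F H) :=
  modelDeriv_surjective_of_submersion (E := E) (hproj.isSubmersionAt 1)

variable {k : ℕ} (S : SymmetricStructure E k H)

theorem SymmetricStructure.mem_grade_zero (X : GroupLieAlgebra 𝓘(ℝ, E) G) :
    X ∈ S.grade 0 ↔ X ∈ subgroupLieAlgebra E H := by
  rw [← S.grade_zero]; rfl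

theorem SymmetricStructure.projDeriv_eq_zero_iff
    (hproj : Manifold.IsSubmersion 𝓘(ℝ, E) 𝓘(ℝ, F) ∞ (fun g : G => (g : G ⧸ H)))
    (X : GroupLieAlgebra 𝓘(ℝ, E) G) : projDeriv E F H X = 0 ↔ X ∈ S.grade 0 := by
  rw [S.mem_grade_zero]
  exact (mem_subgroupLieAlgebra_iff (hproj.isSubmersionAt 1) X).symm

theorem SymmetricStructure.sub_projM_mem (X : GroupLieAlgebra 𝓘(ℝ, E) G) :
    X - S.projM X ∈ S.grade 0 := by
  rw [← Submodule.ker_projectionOnto S.isCompl_m, LinearMap.mem_ker, map_sub, sub_eq_zero]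
  exact (Submodule.projectionOnto_apply_left S.isCompl_m (S.projM X)).symm

theorem SymmetricStructure.projM_coe (X : S.m) : S.projM X = X :=
  Submodule.projectionOnto_apply_left S.isCompl_m X

theorem SymmetricStructure.projM_eq_zero {X : GroupLieAlgebra 𝓘(ℝ, E) G} (hX : X ∈ S.grade 0) :
    S.projM X = 0 := by
  rwa [← LinearMap.mem_ker, SymmetricStructure.projM, Submodule.ker_projectionOnto]

theorem SymmetricStructure.mem_m {γ : Fin k → ZMod 2} (hγ : γ ≠ 0)
    {X : GroupLieAlgebra 𝓘(ℝ, E) G} (hX : X ∈ S.grade γ) : X ∈ S.m :=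
  (le_iSup₂_of_le γ hγ le_rfl : S.grade γ ≤ S.m) hX

theorem SymmetricStructure.projDeriv_projM
    (hproj : Manifold.IsSubmersion 𝓘(ℝ, E) 𝓘(ℝ, F) ∞ (fun g : G => (g : G ⧸ H)))
    (X : GroupLieAlgebra 𝓘(ℝ, E) G) : projDeriv E F H (S.projM X) = projDeriv E F H X := by
  have h := (S.projDeriv_eq_zero_iff hproj _).2 (S.sub_projM_mem X)
  rw [map_sub, sub_eq_zero] at h
  exact h.symm

/-- The differential of the projection identifies `𝔪` with the tangent space of `G ⧸ H`. -/
noncomputable def SymmetricStructure.mEquiv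
    (hproj : Manifold.IsSubmersion 𝓘(ℝ, E) 𝓘(ℝ, F) ∞ (fun g : G => (g : G ⧸ H))) :
    S.m ≃ₗ[ℝ] F :=
  LinearEquiv.ofBijective ((projDeriv E F H).toLinearMap ∘ₗ S.m.subtype) <| by
    constructor
    · rw [← LinearMap.ker_eq_bot, LinearMap.ker_eq_bot']
      intro X hX
      rw [← S.projM_coe X]
      exact S.projM_eq_zero ((S.projDeriv_eq_zero_iff hproj _).1 hX)
    · intro w
      obtain ⟨X, hX⟩ := projDeriv_surjective hproj w
      exact ⟨S.projM X, (S.projDeriv_projM hproj X).trans hX⟩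

theorem SymmetricStructure.mEquiv_apply
    (hproj : Manifold.IsSubmersion 𝓘(ℝ, E) 𝓘(ℝ, F) ∞ (fun g : G => (g : G ⧸ H))) (X : S.m) :
    S.mEquiv hproj X = projDeriv E F H X := rfl

theorem SymmetricStructure.mEquiv_symm_projDeriv
    (hproj : Manifold.IsSubmersion 𝓘(ℝ, E) 𝓘(ℝ, F) ∞ (fun g : G => (g : G ⧸ H)))
    (X : GroupLieAlgebra 𝓘(ℝ, E) G) : (S.mEquiv hproj).symm (projDeriv E F H X) = S.projM X := by
  rw [LinearEquiv.symm_apply_eq, S.mEquiv_apply, S.projDeriv_projM hproj]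

variable [FiniteDimensional ℝ F]

/-- A bilinear form on `𝔪`, viewed as a form on the tangent space of `G ⧸ H` at the base point. -/
noncomputable def SymmetricStructure.tangentForm
    (hproj : Manifold.IsSubmersion 𝓘(ℝ, E) 𝓘(ℝ, F) ∞ (fun g : G => (g : G ⧸ H)))
    (B : LinearMap.BilinForm ℝ S.m) : F →L[ℝ] F →L[ℝ] ℝ :=
  (B.compl₁₂ (S.mEquiv hproj).symm.toLinearMap
    (S.mEquiv hproj).symm.toLinearMap).toContinuousBilinearMap

theorem SymmetricStructure.tangentForm_apply
    (hproj : Manifold.IsSubmersion 𝓘(ℝ, E) 𝓘(ℝ, F) ∞ (fun g : G => (g : G ⧸ H)))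
    (B : LinearMap.BilinForm ℝ S.m) (u v : F) :
    S.tangentForm hproj B u v = B ((S.mEquiv hproj).symm u) ((S.mEquiv hproj).symm v) := rfl

theorem SymmetricStructure.tangentForm_projDeriv
    (hproj : Manifold.IsSubmersion 𝓘(ℝ, E) 𝓘(ℝ, F) ∞ (fun g : G => (g : G ⧸ H)))
    (B : LinearMap.BilinForm ℝ S.m) (X Y : GroupLieAlgebra 𝓘(ℝ, E) G) :
    S.tangentForm hproj B (projDeriv E F H X) (projDeriv E F H Y) =
      B (S.projM X) (S.projM Y) := by
  rw [S.tangentForm_apply, S.mEquiv_symm_projDeriv, S.mEquiv_symm_projDeriv]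

end Isotropy

/-! ### The bracket and the projection on the complement -/

section Bracket

variable {E : Type*} [NormedAddCommGroup E] [NormedSpace ℝ E] [CompleteSpace E]
  {G : Type*} [TopologicalSpace G] [ChartedSpace E G] [Group G] [LieGroup 𝓘(ℝ, E) ∞ G]
  {H : Subgroup G} {k : ℕ} (S : SymmetricStructure E k H)

variable (E G) in
/-- The Lie bracket of the Lie algebra of `G` as a bilinear map. -/
noncomputable def bracketMap : GroupLieAlgebra 𝓘(ℝ, E) G →ₗ[ℝ]
    GroupLieAlgebra 𝓘(ℝ, E) G →ₗ[ℝ] GroupLieAlgebra 𝓘(ℝ, E) G :=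
  have : LieGroup 𝓘(ℝ, E) (minSmoothness ℝ 3) G := LieGroup.of_le (n := ∞) (by simpa using ENat.LEInfty.out)
  LinearMap.mk₂ ℝ (fun X Y => ⁅X, Y⁆) add_lie smul_lie lie_add (fun c X Y => lie_smul c X Y)

theorem bracketMap_apply (X Y : GroupLieAlgebra 𝓘(ℝ, E) G) : bracketMap E G X Y = ⁅X, Y⁆ := rfl

/-- As `𝔥` is a subalgebra, the `𝔥`-component of `X` does not contribute to `[Z, X]_𝔪`. -/
theorem SymmetricStructure.projM_bracket {Z : GroupLieAlgebra 𝓘(ℝ, E) G}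
    (hZ : Z ∈ subgroupLieAlgebra E H) (X : GroupLieAlgebra 𝓘(ℝ, E) G) :
    S.projM ⁅Z, X⁆ = S.projM ⁅Z, (S.projM X : GroupLieAlgebra 𝓘(ℝ, E) G)⁆ := by
  have h1 := S.bracket_mem 0 0 Z ((S.mem_grade_zero Z).2 hZ) _ (S.sub_projM_mem X)
  rw [add_zero] at h1
  have h2 := S.projM_eq_zero h1
  rw [← bracketMap_apply, map_sub, map_sub, sub_eq_zero] at h2
  exact h2

/-- The symmetric product `U` attached to an invariant scalar product on `𝔪`. -/
theorem SymmetricStructure.existsUnique_product [FiniteDimensional ℝ S.m]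
    {B : LinearMap.BilinForm ℝ S.m} (hB : B ∈ S.invariantForms) :
    ∃! U : S.m →ₗ[ℝ] S.m →ₗ[ℝ] S.m, (∀ X Y, U X Y = U Y X) ∧
      ∀ X Y Z : S.m, 2 * B (U X Y) Z =
        B X (S.projM ⁅(Z : GroupLieAlgebra 𝓘(ℝ, E) G), (Y : GroupLieAlgebra 𝓘(ℝ, E) G)⁆) +
        B (S.projM ⁅(Z : GroupLieAlgebra 𝓘(ℝ, E) G), (X : GroupLieAlgebra 𝓘(ℝ, E) G)⁆) Y :=
  existsUnique_koszul hB.1 hB.2.1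
    (((bracketMap E G).compl₁₂ S.m.subtype S.m.subtype).compr₂ S.projM)

end Bracket

/-! ### The bilinear form of an invariant metric -/

section InvariantForm

variable {E : Type*} [NormedAddCommGroup E] [NormedSpace ℝ E]
  {G : Type*} [TopologicalSpace G] [ChartedSpace E G] [Group G] [LieGroup 𝓘(ℝ, E) ∞ G]
  {H : Subgroup G}
  {F : Type*} [NormedAddCommGroup F] [NormedSpace ℝ F] [ChartedSpace F (G ⧸ H)]
  {k : ℕ} (S : SymmetricStructure E k H)

theorem smul_one_eq_of_mem {G : Type*} [Group G] {H : Subgroup G} {h : G} (hh : h ∈ H) :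
    h • ((1 : G) : G ⧸ H) = ((1 : G) : G ⧸ H) := by
  rw [smul_eq_one_iff, mul_one]
  exact hh

theorem SymmetricStructure.IsAdInvariant.projM_add_projM [CompleteSpace E]
    {S : SymmetricStructure E k H} {B : LinearMap.BilinForm ℝ S.m} (hB : S.IsAdInvariant B)
    {Z : GroupLieAlgebra 𝓘(ℝ, E) G} (hZ : Z ∈ subgroupLieAlgebra E H)
    (X Y : GroupLieAlgebra 𝓘(ℝ, E) G) :
    B (S.projM ⁅Z, X⁆) (S.projM Y) + B (S.projM X) (S.projM ⁅Z, Y⁆) = 0 := by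
  rw [S.projM_bracket hZ X, S.projM_bracket hZ Y]
  exact hB Z hZ (S.projM X) (S.projM Y)

/-- An `ad(H)`-invariant form on `𝔪` gives a form on the tangent space at the base point that is
invariant under the isotropy representation of the connected group `H`. -/
theorem SymmetricStructure.tangentForm_smulDeriv [CompleteSpace E] [FiniteDimensional ℝ F]
    (hproj : Manifold.IsSubmersion 𝓘(ℝ, E) 𝓘(ℝ, F) ∞ (fun g : G => (g : G ⧸ H)))
    (hconn : IsConnected (H : Set G)) {B : LinearMap.BilinForm ℝ S.m} (hB : S.IsAdInvariant B)
    {h : G} (hh : h ∈ H) (u v : F) :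
    S.tangentForm hproj B (smulDeriv F h ((1 : G) : G ⧸ H) u)
      (smulDeriv F h ((1 : G) : G ⧸ H) v) = S.tangentForm hproj B u v := by
  obtain ⟨X, rfl⟩ := modelDeriv_surjective_of_submersion (hproj.isSubmersionAt 1) u
  obtain ⟨Y, rfl⟩ := modelDeriv_surjective_of_submersion (hproj.isSubmersionAt 1) v
  rw [← modelDeriv_mk_adjointOrbit hproj hh, ← modelDeriv_mk_adjointOrbit hproj hh]
  refine bilin_adjointOrbit_eq (b := (S.tangentForm hproj B).bilinearComp
    (modelDeriv E F (fun g : G => (g : G ⧸ H)) 1) (modelDeriv E F (fun g : G => (g : G ⧸ H)) 1))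
    (hproj.isSubmersionAt 1) hconn (fun Z hZ X Y => ?_) hh X Y
  refine Eq.trans ?_ (hB.projM_add_projM hZ X Y)
  exact congrArg₂ (fun p q : ℝ => p + q)
    (S.tangentForm_projDeriv hproj B _ Y) (S.tangentForm_projDeriv hproj B X _)

variable [IsManifold 𝓘(ℝ, F) ∞ (G ⧸ H)]

omit [LieGroup 𝓘(ℝ, E) ∞ G] in
theorem formOf_apply (g : Metric F H) (X Y : S.m) : formOf S g X Y =
    innerAt g ((1 : G) : G ⧸ H) (projDeriv E F H X) (projDeriv E F H Y) := rfl

omit [LieGroup 𝓘(ℝ, E) ∞ G] in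
theorem innerAt_projDeriv
    (hproj : Manifold.IsSubmersion 𝓘(ℝ, E) 𝓘(ℝ, F) ∞ (fun g : G => (g : G ⧸ H)))
    (g : Metric F H) (X Y : GroupLieAlgebra 𝓘(ℝ, E) G) :
    innerAt g ((1 : G) : G ⧸ H) (projDeriv E F H X) (projDeriv E F H Y) =
      formOf S g (S.projM X) (S.projM Y) := by
  rw [formOf_apply, S.projDeriv_projM hproj, S.projDeriv_projM hproj]

/-- An invariant metric at the base point is invariant under the isotropy representation, hence its
pull-back to `𝔤` under `Ad H`, and the infinitesimal form of this is the `ad(H)`-invariance. -/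
theorem isAdInvariant_formOf [CompleteSpace E]
    (hproj : Manifold.IsSubmersion 𝓘(ℝ, E) 𝓘(ℝ, F) ∞ (fun g : G => (g : G ⧸ H)))
    {g : Metric F H} (hg : IsInvariant g) : S.IsAdInvariant (formOf S g) := by
  intro Z hZ X Y
  have h1 := bilin_modelBracket_eq_zero (H := H) (b := (innerAt g ((1 : G) : G ⧸ H)).bilinearComp
    (modelDeriv E F (fun g : G => (g : G ⧸ H)) 1) (modelDeriv E F (fun g : G => (g : G ⧸ H)) 1))
    (fun h hh X Y => ?_) hZ (X : GroupLieAlgebra 𝓘(ℝ, E) G) (Y : GroupLieAlgebra 𝓘(ℝ, E) G)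
  · refine Eq.trans ?_ h1
    refine congrArg₂ (fun p q : ℝ => p + q) ?_ ?_
    · refine Eq.trans ?_ (innerAt_projDeriv S hproj g _ Y).symm
      rw [S.projM_coe]
      rfl
    · refine Eq.trans ?_ (innerAt_projDeriv S hproj g X _).symm
      rw [S.projM_coe]
      rfl
  · refine Eq.trans ?_ (innerAt_eq_of_isInvariant hg (smul_one_eq_of_mem hh) _ _).symm
    exact congrArg₂ (fun p q : F => innerAt g ((1 : G) : G ⧸ H) p q)
      (modelDeriv_mk_adjointOrbit hproj hh X) (modelDeriv_mk_adjointOrbit hproj hh Y)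

omit [LieGroup 𝓘(ℝ, E) ∞ G] in
theorem eq_of_formOf_eq
    (hproj : Manifold.IsSubmersion 𝓘(ℝ, E) 𝓘(ℝ, F) ∞ (fun g : G => (g : G ⧸ H)))
    {g g' : Metric F H} (hg : IsInvariant g) (hg' : IsInvariant g')
    (h : formOf S g = formOf S g') : g = g' := by
  refine metric_ext fun x u v => ?_
  obtain ⟨a, ha⟩ := exists_smul_eq_one x
  rw [innerAt_eq_of_isInvariant hg ha, innerAt_eq_of_isInvariant hg' ha]
  obtain ⟨X, hX⟩ := projDeriv_surjective hproj (smulDeriv F a x u)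
  obtain ⟨Y, hY⟩ := projDeriv_surjective hproj (smulDeriv F a x v)
  rw [← hX, ← hY, innerAt_projDeriv S hproj, innerAt_projDeriv S hproj, h]

omit [LieGroup 𝓘(ℝ, E) ∞ G] in
theorem SymmetricStructure.modelDeriv_symm {a γ : Fin k → ZMod 2}
    {X : GroupLieAlgebra 𝓘(ℝ, E) G} (hX : X ∈ S.grade γ) :
    modelDeriv E E (S.symm a) 1 X = sign a γ • (X : E) :=
  S.differential_symm a γ X hX

omit [LieGroup 𝓘(ℝ, E) ∞ G] in
theorem SymmetricStructure.mdifferentiableAt_symm (a : Fin k → ZMod 2) (x : G) :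
    MDifferentiableAt 𝓘(ℝ, E) 𝓘(ℝ, E) (S.symm a) x :=
  (S.contMDiff_symm a).contMDiffAt.mdifferentiableAt (by simp)

omit [LieGroup 𝓘(ℝ, E) ∞ G] [IsManifold 𝓘(ℝ, F) ∞ (G ⧸ H)] in
/-- A map of `G ⧸ H` that lifts to `s_a` acts on the image of `𝔤_γ` in the tangent space by the
sign attached to `a` and `γ`. -/
theorem SymmetricStructure.modelDeriv_of_lift
    (hproj : Manifold.IsSubmersion 𝓘(ℝ, E) 𝓘(ℝ, F) ∞ (fun g : G => (g : G ⧸ H)))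
    {a γ : Fin k → ZMod 2} {f : G ⧸ H → G ⧸ H}
    (hf : MDifferentiableAt 𝓘(ℝ, F) 𝓘(ℝ, F) f ((1 : G) : G ⧸ H))
    (hlift : ∀ g : G, f (g : G ⧸ H) = (S.symm a g : G ⧸ H))
    {X : GroupLieAlgebra 𝓘(ℝ, E) G} (hX : X ∈ S.grade γ) :
    modelDeriv F F f ((1 : G) : G ⧸ H) (projDeriv E F H X) = sign a γ • projDeriv E F H X := by
  have hπ : MDifferentiableAt 𝓘(ℝ, E) 𝓘(ℝ, F) (fun g : G => (g : G ⧸ H)) 1 :=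
    hproj.contMDiff.contMDiffAt.mdifferentiableAt (by simp)
  have h1 := modelDeriv_comp_apply hf hπ rfl X
  simp only [hlift] at h1
  refine h1.symm.trans ?_
  refine (modelDeriv_comp_apply hπ (S.mdifferentiableAt_symm a 1) (map_one _) X).trans ?_
  refine (congrArg _ (S.modelDeriv_symm hX)).trans ?_
  exact map_smul (projDeriv E F H) _ _

omit [LieGroup 𝓘(ℝ, E) ∞ G] in
/-- The symmetry `s_a` at the base point is an isometry that multiplies `B(X, Y)` by a sign. For
components of different degrees, some `a` makes this sign equal to `-1`. -/
theorem isGradedOrthogonal_formOf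
    (hproj : Manifold.IsSubmersion 𝓘(ℝ, E) 𝓘(ℝ, F) ∞ (fun g : G => (g : G ⧸ H)))
    {g : Metric F H} (hg : IsAdapted S g) : S.IsGradedOrthogonal (formOf S g) := by
  intro γ γ' hne X Y hX hY
  obtain ⟨a, ha⟩ := exists_sign_mul_ne_one hne
  obtain ⟨f, hf, hpres⟩ := hg a ((1 : G) : G ⧸ H)
  have hlift : ∀ x : G, f (x : G ⧸ H) = (S.symm a x : G ⧸ H) := by
    intro x
    have := hf 1 x rfl
    rwa [inv_one, one_mul, one_mul] at this
  have hone : f ((1 : G) : G ⧸ H) = ((1 : G) : G ⧸ H) := by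
    rw [hlift, map_one]
  have hfd : MDifferentiableAt 𝓘(ℝ, F) 𝓘(ℝ, F) f ((1 : G) : G ⧸ H) :=
    f.contMDiff.contMDiffAt.mdifferentiableAt (by simp)
  have h1 := preserves_iff.1 hpres ((1 : G) : G ⧸ H) (projDeriv E F H X) (projDeriv E F H Y)
  rw [hone, S.modelDeriv_of_lift hproj hfd hlift hX, S.modelDeriv_of_lift hproj hfd hlift hY,
    map_smul, map_smul, smul_apply, smul_eq_mul, smul_eq_mul, ← formOf_apply, ← mul_assoc,
    mul_comm (sign a γ')] at h1
  by_contra h0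
  exact ha (mul_right_cancel₀ h0 (h1.trans (one_mul _).symm))

end InvariantForm

/-! ### The symmetries of the homogeneous space -/

section Symmetry

/-- The map of `G ⧸ H` induced by an automorphism of `G` that fixes `H` pointwise. -/
def quotientMap {G : Type*} [Group G] {H : Subgroup G} (s : G ≃* G) (hs : ∀ h ∈ H, s h = h) :
    G ⧸ H → G ⧸ H :=
  Quotient.map' s fun x y hxy => by
    rw [QuotientGroup.leftRel_apply] at hxy ⊢
    rw [← map_inv, ← map_mul, hs _ hxy]
    exact hxy

theorem quotientMap_mk {G : Type*} [Group G] {H : Subgroup G} {s : G ≃* G}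
    (hs : ∀ h ∈ H, s h = h) (g : G) : quotientMap s hs (g : G ⧸ H) = (s g : G ⧸ H) := rfl

theorem quotientMap_smul {G : Type*} [Group G] {H : Subgroup G} {s : G ≃* G}
    (hs : ∀ h ∈ H, s h = h) (a : G) (y : G ⧸ H) :
    quotientMap s hs (a • y) = s a • quotientMap s hs y := by
  obtain ⟨g, rfl⟩ := QuotientGroup.mk_surjective y
  exact congrArg (fun x : G => (x : G ⧸ H)) (map_mul s a g)

theorem symm_apply_eq_self {G : Type*} [Group G] {H : Subgroup G} {s : G ≃* G}
    (hs : ∀ h ∈ H, s h = h) : ∀ h ∈ H, s.symm h = h := fun h hh => by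
  rw [MulEquiv.symm_apply_eq, hs h hh]

variable {E : Type*} [NormedAddCommGroup E] [NormedSpace ℝ E]
  {G : Type*} [TopologicalSpace G] [ChartedSpace E G] [Group G]
  {H : Subgroup G}
  {F : Type*} [NormedAddCommGroup F] [NormedSpace ℝ F] [ChartedSpace F (G ⧸ H)]

theorem contMDiff_quotientMap
    (hproj : Manifold.IsSubmersion 𝓘(ℝ, E) 𝓘(ℝ, F) ∞ (fun g : G => (g : G ⧸ H)))
    {s : G ≃* G} (hs : ∀ h ∈ H, s h = h) (hsm : ContMDiff 𝓘(ℝ, E) 𝓘(ℝ, E) ∞ s) :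
    ContMDiff 𝓘(ℝ, F) 𝓘(ℝ, F) ∞ (quotientMap s hs) := by
  intro y
  obtain ⟨g, rfl⟩ := QuotientGroup.mk_surjective y
  exact contMDiffAt_of_comp_submersion (hproj.isSubmersionAt g)
    (hproj.contMDiff.comp hsm).contMDiffAt

variable [LieGroup 𝓘(ℝ, E) ∞ G]

/-- The map of `G ⧸ H` induced by `s`, moved from the base point to the point `g₀ H`. -/
def symmetryDiffeomorph
    (hproj : Manifold.IsSubmersion 𝓘(ℝ, E) 𝓘(ℝ, F) ∞ (fun g : G => (g : G ⧸ H)))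
    {s : G ≃* G} (hs : ∀ h ∈ H, s h = h) (hsm : ContMDiff 𝓘(ℝ, E) 𝓘(ℝ, E) ∞ s)
    (hsm' : ContMDiff 𝓘(ℝ, E) 𝓘(ℝ, E) ∞ s.symm) (g₀ : G) :
    Diffeomorph 𝓘(ℝ, F) 𝓘(ℝ, F) (G ⧸ H) (G ⧸ H) ∞ where
  toFun y := g₀ • quotientMap s hs (g₀⁻¹ • y)
  invFun y := g₀ • quotientMap s.symm (symm_apply_eq_self hs) (g₀⁻¹ • y)
  left_inv y := by
    obtain ⟨g, rfl⟩ := QuotientGroup.mk_surjective y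
    simp only [inv_smul_smul, smul_eq_iff_eq_inv_smul]
    exact congrArg (fun x : G => (x : G ⧸ H)) (s.symm_apply_apply _)
  right_inv y := by
    obtain ⟨g, rfl⟩ := QuotientGroup.mk_surjective y
    simp only [inv_smul_smul, smul_eq_iff_eq_inv_smul]
    exact congrArg (fun x : G => (x : G ⧸ H)) (s.apply_symm_apply _)
  contMDiff_toFun := (contMDiff_smul_right hproj g₀).comp
    ((contMDiff_quotientMap hproj hs hsm).comp (contMDiff_smul_right hproj g₀⁻¹))
  contMDiff_invFun := (contMDiff_smul_right hproj g₀).comp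
    ((contMDiff_quotientMap hproj _ hsm').comp (contMDiff_smul_right hproj g₀⁻¹))

/-- The diffeomorphism is the symmetry at `g₀ H` for every choice of a representative of this coset,
because `s_a` fixes `H` pointwise. -/
theorem isSymmetryAt_symmetryDiffeomorph {k : ℕ} (S : SymmetricStructure E k H)
    (hproj : Manifold.IsSubmersion 𝓘(ℝ, E) 𝓘(ℝ, F) ∞ (fun g : G => (g : G ⧸ H)))
    {a : Fin k → ZMod 2} (hs : ∀ h ∈ H, S.symm a h = h) (g₀ : G) :
    IsSymmetryAt S a (g₀ : G ⧸ H)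
      (symmetryDiffeomorph hproj hs (S.contMDiff_symm a) (S.contMDiff_symm_inv a) g₀) := by
  intro g₁ g h1
  have hh : g₁⁻¹ * g₀ ∈ H := QuotientGroup.eq.1 h1
  have h2 : g₁ * S.symm a (g₁⁻¹ * g) = g₀ * S.symm a (g₀⁻¹ * g) := by
    have h3 : g₁⁻¹ * g = (g₁⁻¹ * g₀) * (g₀⁻¹ * g) := by group
    rw [h3, map_mul, hs _ hh]
    group
  rw [h2]
  rfl

variable [IsManifold 𝓘(ℝ, F) ∞ (G ⧸ H)]

omit [ChartedSpace E G] [LieGroup 𝓘(ℝ, E) ∞ G] in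
theorem Preserves.comp {g : Metric F H} {f f' : G ⧸ H → G ⧸ H} (hf : Preserves g f)
    (hf' : Preserves g f') (hd : ∀ y, MDifferentiableAt 𝓘(ℝ, F) 𝓘(ℝ, F) f y)
    (hd' : ∀ y, MDifferentiableAt 𝓘(ℝ, F) 𝓘(ℝ, F) f' y) :
    Preserves g (fun y => f (f' y)) := by
  rw [preserves_iff] at *
  intro y u v
  rw [modelDeriv_comp_apply (hd _) (hd' y) rfl, modelDeriv_comp_apply (hd _) (hd' y) rfl,
    hf, hf']

/-- For an invariant metric, the map induced by an automorphism is an isometry as soon as its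
differential at the base point is one. -/
theorem preserves_quotientMap
    (hproj : Manifold.IsSubmersion 𝓘(ℝ, E) 𝓘(ℝ, F) ∞ (fun g : G => (g : G ⧸ H)))
    {s : G ≃* G} (hs : ∀ h ∈ H, s h = h) (hsm : ContMDiff 𝓘(ℝ, E) 𝓘(ℝ, E) ∞ s)
    {g : Metric F H} (hg : IsInvariant g)
    (hone : ∀ u v : F, innerAt g ((1 : G) : G ⧸ H)
      (modelDeriv F F (quotientMap s hs) ((1 : G) : G ⧸ H) u)
      (modelDeriv F F (quotientMap s hs) ((1 : G) : G ⧸ H) v) =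
        innerAt g ((1 : G) : G ⧸ H) u v) :
    Preserves g (quotientMap s hs) := by
  rw [preserves_iff]
  intro y u v
  have hd : ∀ y, MDifferentiableAt 𝓘(ℝ, F) 𝓘(ℝ, F) (quotientMap s hs) y := fun y =>
    (contMDiff_quotientMap hproj hs hsm).contMDiffAt.mdifferentiableAt (by simp)
  obtain ⟨a, ha⟩ := exists_smul_eq_one y
  have ha' : s a • quotientMap s hs y = ((1 : G) : G ⧸ H) := by
    rw [← quotientMap_smul, ha, quotientMap_mk, map_one]
  have key : ∀ w, smulDeriv F (s a) (quotientMap s hs y) (modelDeriv F F (quotientMap s hs) y w) =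
      modelDeriv F F (quotientMap s hs) ((1 : G) : G ⧸ H) (smulDeriv F a y w) := by
    intro w
    rw [smulDeriv, smulDeriv, ← modelDeriv_comp_apply (mdifferentiableAt_smul hproj _ _) (hd y) rfl,
      ← modelDeriv_comp_apply (hd _) (mdifferentiableAt_smul hproj _ _) ha]
    simp only [quotientMap_smul]
  rw [innerAt_eq_of_isInvariant hg ha', innerAt_eq_of_isInvariant hg ha, key, key, hone]

variable {k : ℕ} (S : SymmetricStructure E k H)

omit [IsManifold 𝓘(ℝ, F) ∞ (G ⧸ H)] in
/-- The symmetries fix `H` pointwise, since their differentials are the identity on `𝔤_e = 𝔥`. -/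
theorem SymmetricStructure.symm_apply_of_mem
    (hproj : Manifold.IsSubmersion 𝓘(ℝ, E) 𝓘(ℝ, F) ∞ (fun g : G => (g : G ⧸ H)))
    (hconn : IsConnected (H : Set G)) (a : Fin k → ZMod 2) : ∀ h ∈ H, S.symm a h = h := by
  refine apply_eq_self_of_modelDeriv_eq (hproj.isSubmersionAt 1) hconn (S.contMDiff_symm a)
    fun X hX => ?_
  refine (S.modelDeriv_symm ((S.mem_grade_zero X).2 hX)).trans ?_
  rw [sign_zero]
  exact one_smul ℝ (X : E)

omit [LieGroup 𝓘(ℝ, E) ∞ G] in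
/-- An invariant metric for which the components of the grading are orthogonal is invariant under
the differentials of the symmetries at the base point. -/
theorem SymmetricStructure.innerAt_quotientMap
    (hproj : Manifold.IsSubmersion 𝓘(ℝ, E) 𝓘(ℝ, F) ∞ (fun g : G => (g : G ⧸ H)))
    {a : Fin k → ZMod 2} (hs : ∀ h ∈ H, S.symm a h = h) {g : Metric F H}
    (hB : S.IsGradedOrthogonal (formOf S g)) (u v : F) :
    innerAt g ((1 : G) : G ⧸ H)
      (modelDeriv F F (quotientMap (S.symm a) hs) ((1 : G) : G ⧸ H) u)
      (modelDeriv F F (quotientMap (S.symm a) hs) ((1 : G) : G ⧸ H) v) =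
        innerAt g ((1 : G) : G ⧸ H) u v := by
  have hd : MDifferentiableAt 𝓘(ℝ, F) 𝓘(ℝ, F) (quotientMap (S.symm a) hs) ((1 : G) : G ⧸ H) :=
    (contMDiff_quotientMap hproj hs (S.contMDiff_symm a)).contMDiffAt.mdifferentiableAt (by simp)
  obtain ⟨X, rfl⟩ := projDeriv_surjective hproj u
  obtain ⟨Y, rfl⟩ := projDeriv_surjective hproj v
  have hpair : ∀ (γ γ' : Fin k → ZMod 2) (X Y : GroupLieAlgebra 𝓘(ℝ, E) G), X ∈ S.grade γ →
      Y ∈ S.grade γ' → innerAt g ((1 : G) : G ⧸ H)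
        (modelDeriv F F (quotientMap (S.symm a) hs) ((1 : G) : G ⧸ H) (projDeriv E F H X))
        (modelDeriv F F (quotientMap (S.symm a) hs) ((1 : G) : G ⧸ H) (projDeriv E F H Y)) =
        innerAt g ((1 : G) : G ⧸ H) (projDeriv E F H X) (projDeriv E F H Y) := by
    intro γ γ' X Y hX hY
    rw [S.modelDeriv_of_lift hproj hd (quotientMap_mk hs) hX,
      S.modelDeriv_of_lift hproj hd (quotientMap_mk hs) hY, map_smul, map_smul, smul_apply,
      smul_eq_mul, smul_eq_mul]
    rcases eq_or_ne γ γ' with rfl | hne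
    · rw [← mul_assoc, sign_mul_self, one_mul]
    rcases eq_or_ne γ 0 with rfl | h0
    · rw [(S.projDeriv_eq_zero_iff hproj X).2 hX]
      simp
    rcases eq_or_ne γ' 0 with rfl | h0'
    · rw [(S.projDeriv_eq_zero_iff hproj Y).2 hY]
      simp
    have h1 := hB γ γ' hne ⟨X, S.mem_m h0 hX⟩ ⟨Y, S.mem_m h0' hY⟩ hX hY
    rw [formOf_apply] at h1
    rw [h1, mul_zero, mul_zero]
  have htop : ∀ X : GroupLieAlgebra 𝓘(ℝ, E) G, X ∈ ⨆ γ, S.grade γ := by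
    intro X
    rw [S.isInternal.submodule_iSup_eq_top]
    trivial
  induction htop X using Submodule.iSup_induction' with
  | zero => simp
  | add X X' _ _ h h' => simp only [map_add, add_apply, h, h']
  | mem γ X hX =>
    induction htop Y using Submodule.iSup_induction' with
    | zero => simp
    | add Y Y' _ _ h h' => simp only [map_add, h, h']
    | mem γ' Y hY => exact hpair γ γ' X Y hX hY

theorem isAdapted_of_isGradedOrthogonal
    (hproj : Manifold.IsSubmersion 𝓘(ℝ, E) 𝓘(ℝ, F) ∞ (fun g : G => (g : G ⧸ H)))
    (hconn : IsConnected (H : Set G)) {g : Metric F H} (hg : IsInvariant g)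
    (hB : S.IsGradedOrthogonal (formOf S g)) : IsAdapted S g := by
  intro a x
  obtain ⟨g₀, rfl⟩ := QuotientGroup.mk_surjective x
  have hs := S.symm_apply_of_mem hproj hconn a
  refine ⟨_, isSymmetryAt_symmetryDiffeomorph S hproj hs g₀, ?_⟩
  have hq := preserves_quotientMap hproj hs (S.contMDiff_symm a) hg
    (S.innerAt_quotientMap hproj hs hB)
  have hd : ∀ y, MDifferentiableAt 𝓘(ℝ, F) 𝓘(ℝ, F) (quotientMap (S.symm a) hs) y := fun y =>
    (contMDiff_quotientMap hproj hs (S.contMDiff_symm a)).contMDiffAt.mdifferentiableAt (by simp)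
  have h1 := hq.comp (hg g₀⁻¹) hd (mdifferentiableAt_smul hproj _)
  exact (hg g₀).comp h1 (mdifferentiableAt_smul hproj _)
    fun y => mdifferentiableAt_comp (hd _) (mdifferentiableAt_smul hproj _ y) rfl

end Symmetry

/-! ### Metrics and invariant forms -/

section Correspondence

variable {E : Type*} [NormedAddCommGroup E] [NormedSpace ℝ E] [CompleteSpace E]
  {G : Type*} [TopologicalSpace G] [ChartedSpace E G] [Group G] [LieGroup 𝓘(ℝ, E) ∞ G]
  {H : Subgroup G}
  {F : Type*} [NormedAddCommGroup F] [NormedSpace ℝ F] [ChartedSpace F (G ⧸ H)]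
  [IsManifold 𝓘(ℝ, F) ∞ (G ⧸ H)]
  {k : ℕ} (S : SymmetricStructure E k H)

theorem formOf_mem_invariantForms
    (hproj : Manifold.IsSubmersion 𝓘(ℝ, E) 𝓘(ℝ, F) ∞ (fun g : G => (g : G ⧸ H)))
    {g : Metric F H} (hg : IsInvariant g) (hg' : IsAdapted S g) :
    formOf S g ∈ S.invariantForms := by
  refine ⟨fun X Y => g.symm _ _ _, fun X hX => g.pos _ _ fun h => hX ?_,
    isAdInvariant_formOf S hproj hg, isGradedOrthogonal_formOf S hproj hg'⟩
  exact (S.mEquiv hproj).map_eq_zero_iff.1 h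

theorem exists_formOf_eq [FiniteDimensional ℝ F]
    (hproj : Manifold.IsSubmersion 𝓘(ℝ, E) 𝓘(ℝ, F) ∞ (fun g : G => (g : G ⧸ H)))
    (hconn : IsConnected (H : Set G)) {B : LinearMap.BilinForm ℝ S.m}
    (hB : B ∈ S.invariantForms) :
    ∃ g : Metric F H, IsInvariant g ∧ IsAdapted S g ∧ formOf S g = B := by
  obtain ⟨hsymm, hpos, had, horth⟩ := hB
  have hsymm' : ∀ u v, S.tangentForm hproj B u v = S.tangentForm hproj B v u :=
    fun u v => hsymm _ _
  have hpos' : ∀ u, u ≠ 0 → 0 < S.tangentForm hproj B u u := fun u hu =>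
    hpos _ fun h => hu ((S.mEquiv hproj).symm.map_eq_zero_iff.1 h)
  have hinv : ∀ h ∈ H, ∀ u v, S.tangentForm hproj B (smulDeriv F h ((1 : G) : G ⧸ H) u)
      (smulDeriv F h ((1 : G) : G ⧸ H) v) = S.tangentForm hproj B u v :=
    fun h hh u v => S.tangentForm_smulDeriv hproj hconn had hh u v
  set g := invariantMetric hproj (S.tangentForm hproj B) hsymm' hpos' hinv with hg
  have hgi : IsInvariant g := isInvariant_invariantMetric hproj hsymm' hpos' hinv
  have hform : formOf S g = B := by
    ext X Y
    rw [formOf_apply, hg, innerAt_invariantMetric hproj hsymm' hpos' hinv (one_smul G _),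
      smulDeriv_one, smulDeriv_one, S.tangentForm_projDeriv, S.projM_coe, S.projM_coe]
  refine ⟨g, hgi, isAdapted_of_isGradedOrthogonal S hproj hconn hgi ?_, hform⟩
  rwa [hform]

end Correspondence

end Z2kSymmetric

theorem proposition4
    {E : Type*} [NormedAddCommGroup E] [NormedSpace ℝ E] [FiniteDimensional ℝ E]
    {G : Type*} [TopologicalSpace G] [ChartedSpace E G] [Group G] [LieGroup 𝓘(ℝ, E) ∞ G]
    [ConnectedSpace G]
    (H : Subgroup G) (hclosed : IsClosed (H : Set G)) (hconn : IsConnected (H : Set G))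
    {F : Type*} [NormedAddCommGroup F] [NormedSpace ℝ F] [FiniteDimensional ℝ F]
    [ChartedSpace F (G ⧸ H)] [IsManifold 𝓘(ℝ, F) ∞ (G ⧸ H)]
    (hproj : Manifold.IsSubmersion 𝓘(ℝ, E) 𝓘(ℝ, F) ∞ (fun g : G => (g : G ⧸ H)))
    {k : ℕ} (S : Z2kSymmetric.SymmetricStructure E k H) :
    Set.BijOn (Z2kSymmetric.formOf S)
      {g : Z2kSymmetric.Metric F H |
        Z2kSymmetric.IsInvariant g ∧ Z2kSymmetric.IsAdapted S g}
      S.invariantForms ∧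
    ∀ B ∈ S.invariantForms, ∃! U : S.m →ₗ[ℝ] S.m →ₗ[ℝ] S.m,
      (∀ X Y, U X Y = U Y X) ∧
      ∀ X Y Z : S.m, 2 * B (U X Y) Z =
        B X (S.projM ⁅(Z : GroupLieAlgebra 𝓘(ℝ, E) G), (Y : GroupLieAlgebra 𝓘(ℝ, E) G)⁆) +
        B (S.projM ⁅(Z : GroupLieAlgebra 𝓘(ℝ, E) G), (X : GroupLieAlgebra 𝓘(ℝ, E) G)⁆) Y := by
  have : CompleteSpace E := FiniteDimensional.complete ℝ E
  have : FiniteDimensional ℝ (GroupLieAlgebra 𝓘(ℝ, E) G) :=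
    inferInstanceAs (FiniteDimensional ℝ E)
  refine ⟨⟨?_, ?_, ?_⟩, fun B hB => S.existsUnique_product hB⟩
  · rintro g ⟨hg, hg'⟩
    exact Z2kSymmetric.formOf_mem_invariantForms S hproj hg hg'
  · rintro g ⟨hg, -⟩ g' ⟨hg', -⟩ h
    exact Z2kSymmetric.eq_of_formOf_eq S hproj hg hg' h
  · intro B hB
    obtain ⟨g, hg, hg', h⟩ := Z2kSymmetric.exists_formOf_eq S hproj hconn hB
    exact ⟨g, ⟨hg, hg'⟩, h⟩
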